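/- **Setting.** Let $\mathrm{Nil}_3=\mathbb R^3$ with $x\cdot\tilde x=(x_1+\tilde x_1,\,x_2+\tilde x_2,\,x_3+\tilde x_3+\tfrac12(x_1\tilde x_2-\tilde x_1x_2))$, with the left-invariant metric $dx_1^2+dx_2^2+(dx_3+\tfrac12(x_2dx_1-x_1dx_2))^2$, and let $e_1,e_2,e_3$ be the left-invariant orthonormal frame equal to $\partial_1,\partial_2,\partial_3$ at the origin. For a smooth conformal immersion $f$ of an open subset of $\mathbb C$ (coordinate $z=x+iy$) write $f^{-1}f_z=\sum_k\phi_ke_k$ and let $e^u=|f_x|^2$; let $N$ be the positively oriented unit normal, $H$ the mean curvature and $h=e^{u/2}\langle f^{-1}N,e_3\rangle$. The immersion $f$ is nowhere vertical if $\langle f^{-1}N,e_3\rangle\ne0$ everywhere, and minimal if $H=0$; for minimal $f$ put $B=\tfrac i4\bigl(\langle f_{zz},N\rangle+\phi_3^2/i\bigr)$. Generating spinors $\psi_1,\psi_2$ of $f$ are functions with $\phi_1=\overline{\psi_2}^2-\psi_1^2$, $\phi_2=i(\overline{\psi_2}^2+\psi_1^2)$, $\phi_3=2\psi_1\overline{\psi_2}$.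 For a nowhere-vertical minimal $f$, on an open set where $B\neq0$, a surface $f^*$ is called *dual* to $f$ if $\psi_1^*=\frac{4\sqrt{-B}}{h}\psi_2$, $\psi_2^*=\frac{4\,\overline{\sqrt{-B}}}{h}\psi_1$ are generating spinors of $f^*$; the choices of signs of the root and of the spinors are immaterial. For the *normal Gauss map* $g$ of a nowhere-vertical surface, take the upward one of the unit normals $\pm f^{-1}N$ and project it stereographically from the south pole; so $|g|<1$. The disk is identified with the hyperbolic plane $\{x_1\mathcal E_1+x_2\mathcal E_2+x_3\mathcal E_3:\ x_1^2+x_2^2-x_3^2=-1,\ x_3<0\}\subset\mathfrak{su}_{1,1}$ by $$g\longmapsto \frac{i}{2(1-|g|^2)}\begin{pmatrix}1+|g|^2&2ig\\2i\bar g&-(1+|g|^2)\end{pmatrix},$$ $$\mathcal E_1=\tfrac12\begin{pmatrix}0&i\\-i&0\end{pmatrix},\quad \mathcal E_2=\tfrac12\begin{pmatrix}0&-1\\-1&0\end{pmatrix},\quad \mathcal E_3=\tfrac12\begin{pmatrix}-i&0\\0&i\end{pmatrix}.$$ Let $D\subset\mathbb C$ be a nonempty connected open set and $f:D\to\mathrm{Nil}_3$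 a nowhere-vertical conformal minimal immersion whose positively oriented unit normal is upward, with $B\not\equiv0$. Put $e^{w/2}=\frac i4h$. An *extended frame* of $f$ is a map $F:\mathbb S^1\times D\to\mathrm{SU}_{1,1}$, smooth in $(\lambda,z)$, with $F^{-1}dF=U^\lambda dz+V^\lambda d\bar z$ for each $\lambda\in\mathbb S^1$, where $$U^\lambda=\begin{pmatrix}\frac14w_z&-\lambda^{-1}e^{w/2}\\\lambda^{-1}Be^{-w/2}&-\frac14w_z\end{pmatrix},\qquad V^\lambda=\begin{pmatrix}-\frac14w_{\bar z}&-\lambda\bar Be^{-w/2}\\\lambda e^{w/2}&\frac14w_{\bar z}\end{pmatrix}.$$ It is *associated with generating spinors of $f$* if, for some generating spinors $\psi_1,\psi_2$ of $f$ on $D$ (with $\sqrt i=e^{i\pi/4}$), $$F|_{\lambda=1}=\frac1{\sqrt{|\psi_1|^2-|\psi_2|^2}}\begin{pmatrix}\sqrt i^{-1}\psi_1&\sqrt i^{-1}\psi_2\\\sqrt i\,\overline{\psi_2}&\sqrt i\,\overline{\psi_1}\end{pmatrix}.$$ **Theorem.** Let $F$ be an extended frame of $f$. Set $N_m=\frac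 i2\mathrm{Ad}(F)\sigma_3$, where $\sigma_3=\mathrm{diag}(1,-1)$, and $m_\pm=-i\lambda(\partial_\lambda F)F^{-1}\pm N_m$, where $\lambda\partial_\lambda=-i\partial_\theta$ for $\lambda=e^{i\theta}$. Let $$f_\pm^\lambda=\Xi_{\rm nil}\Bigl(m_\pm^o-\tfrac i2\lambda(\partial_\lambda m_\pm)^d\Bigr),\qquad \Xi_{\rm nil}\Bigl(\sum_kx_k\mathcal E_k\Bigr)=(x_1,x_2,x_3),$$ where $o$ and $d$ denote the off-diagonal and diagonal parts. The zeros of $B$ are isolated; let $D'=\{z\in D: B(z)\neq0\}$. Then: 1. For each $\lambda\in\mathbb S^1$, $f_-^\lambda$ on $D$ and $f_+^\lambda$ on $D'$ are nowhere-vertical conformal minimal immersions; the positively oriented unit normal of $f_-^\lambda$ is upward and that of $f_+^\lambda$ is downward. 2. For each $\lambda\in\mathbb S^1$, $N_m$ is the normal Gauss map of $f_-^\lambda$ on $D$, and on $D'$ it is the normal Gauss map of $f_+^\lambda$ up to a rigid motion, namely of $f_+^\lambda$ followed by the half-turn $(x_1,x_2,x_3)\mapsto(-x_1,-x_2,x_3)$.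 3. For each $\lambda\in\mathbb S^1$, on $D'$ the surface $f_+^\lambda$ is dual to $f_-^\lambda$, and $f_-^\lambda$ is dual to $f_+^\lambda$. 4. If $F$ is associated with generating spinors of $f$, then $f_-^\lambda|_{\lambda=1}=T\circ f$ on $D$ for some isometry $T$ of $\mathrm{Nil}_3$, and $f_+^\lambda|_{\lambda=1}$ is dual to $f$ on $D'$. -/

import Mathlib

open scoped ContDiff Matrix Topology

noncomputable section

namespace NilSurf

/-! ### The Heisenberg group and its left-invariant metric -/

/-- The manifold underlying the Heisenberg group: `ℝ³` with coordinates `x₁, x₂, x₃`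
(indexed by `0, 1, 2`).  Only its smooth structure and `nilMetric` are used. -/
abbrev Nil3 : Type := Fin 3 → ℝ

/-- The group multiplication of the Heisenberg group. -/
def nilMul (x y : Nil3) : Nil3 :=
  ![x 0 + y 0, x 1 + y 1, x 2 + y 2 + (x 0 * y 1 - y 0 * x 1) / 2]

/-- The metric `dx₁² + dx₂² + (dx₃ + ½ (x₂ dx₁ - x₁ dx₂))²` at the point `x`. -/
def nilMetric (x v w : Nil3) : ℝ :=
  v 0 * w 0 + v 1 * w 1 +
    (v 2 + (x 1 * v 0 - x 0 * v 1) / 2) * (w 2 + (x 1 * w 0 - x 0 * w 1) / 2)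

/-- Left translation of a tangent vector `v` at `x` to the identity, in the basis
`e₁, e₂, e₃` of the Lie algebra (the Maurer-Cartan form). -/
def leftTriv (x v : Nil3) : Fin 3 → ℝ :=
  ![v 0, v 1, v 2 + (x 1 * v 0 - x 0 * v 1) / 2]

/-- `leftTriv` is the derivative of left translation: the curve `t ↦ x⁻¹ · (x + t v)`
is the straight line with velocity `leftTriv x v` (note `x⁻¹ = -x`). -/
theorem nilMul_neg_line (x v : Nil3) (t : ℝ) :
    nilMul (-x) (x + t • v) = t • leftTriv x v := by
  funext i
  fin_cases i <;> simp [nilMul, leftTriv]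
  ring

theorem nilMetric_eq (x v w : Nil3) :
    nilMetric x v w = leftTriv x v ⬝ᵥ leftTriv x w := by
  simp [nilMetric, leftTriv, dotProduct, Fin.sum_univ_three]

/-- The Levi-Civita connection `∇_a b` of the metric on left-invariant vector fields
`a = ∑ aⱼ eⱼ`, `b = ∑ bₖ eₖ`, where `[e₁, e₂] = e₃` is the only nonzero bracket. -/
def nilConn (a b : Fin 3 → ℝ) : Fin 3 → ℝ :=
  ![(a 1 * b 2 + a 2 * b 1) / 2, -(a 0 * b 2 + a 2 * b 0) / 2, (a 0 * b 1 - a 1 * b 0) / 2]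

theorem nilConn_torsion_free (a b : Fin 3 → ℝ) :
    nilConn a b - nilConn b a = ![0, 0, a 0 * b 1 - a 1 * b 0] := by
  funext i
  fin_cases i <;> simp [nilConn] <;> ring

theorem nilConn_metric (a b c : Fin 3 → ℝ) :
    nilConn a b ⬝ᵥ c + b ⬝ᵥ nilConn a c = 0 := by
  simp [nilConn, dotProduct, Fin.sum_univ_three]
  ring

/-- Rigid motions: smooth bijections of the Heisenberg group preserving the metric. -/
def IsRigidMotion (T : Nil3 → Nil3) : Prop :=
  ContDiff ℝ ∞ T ∧ Function.Bijective T ∧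
    ∀ x v w, nilMetric (T x) (fderiv ℝ T x v) (fderiv ℝ T x w) = nilMetric x v w

/-! ### Surfaces in the Heisenberg group; the coordinate is `z = x + i y ∈ ℂ` -/

/-- `f⁻¹ ∂_a f`, for the real direction `a` (`a = 1` is `∂_x`, `a = i` is `∂_y`). -/
def mcForm (f : ℂ → Nil3) (a z : ℂ) : Fin 3 → ℝ :=
  leftTriv (f z) (fderiv ℝ f z a)

/-- The coefficients `φ₁, φ₂, φ₃` of `f⁻¹ f_z = ∑ φₖ eₖ`. -/
def phi (f : ℂ → Nil3) (z : ℂ) (k : Fin 3) : ℂ :=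
  ((mcForm f 1 z k : ℂ) - Complex.I * (mcForm f Complex.I z k : ℂ)) / 2

/-- The conformal factor `e^u = |f_x|²`. -/
def confFactor (f : ℂ → Nil3) (z : ℂ) : ℝ :=
  nilMetric (f z) (fderiv ℝ f z 1) (fderiv ℝ f z 1)

/-- The left translate `f⁻¹ N` of the positively oriented unit normal `N`, in the basis
`e₁, e₂, e₃`. -/
def unitNormal (f : ℂ → Nil3) (z : ℂ) : Fin 3 → ℝ :=
  let c := crossProduct (mcForm f 1 z) (mcForm f Complex.I z)
  (Real.sqrt (c ⬝ᵥ c))⁻¹ • c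

/-- The left translate of the covariant derivative `∇_{∂_a} f_b`. -/
def covDeriv (f : ℂ → Nil3) (a b z : ℂ) : Fin 3 → ℝ :=
  fderiv ℝ (fun w => mcForm f b w) z a + nilConn (mcForm f a z) (mcForm f b z)

/-- The second fundamental form `⟨∇_{∂_a} f_b, N⟩`. -/
def secondForm (f : ℂ → Nil3) (a b z : ℂ) : ℝ :=
  covDeriv f a b z ⬝ᵥ unitNormal f z

/-- The mean curvature of a conformal immersion. -/
def meanCurvature (f : ℂ → Nil3) (z : ℂ) : ℝ :=
  (secondForm f 1 1 z + secondForm f Complex.I Complex.I z) / (2 * confFactor f z)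

/-- `⟨f_zz, N⟩`, the coefficient of the Hopf differential. -/
def hopf (f : ℂ → Nil3) (z : ℂ) : ℂ :=
  ((secondForm f 1 1 z : ℂ) - (secondForm f Complex.I Complex.I z : ℂ)
    - 2 * Complex.I * (secondForm f 1 Complex.I z : ℂ)) / 4

/-- The Abresch-Rosenberg coefficient of a minimal surface: the expression
`B = (2H + i)/4 · (⟨f_zz, N⟩ + φ₃² / (2H + i))` with `H = 0`. -/
def abreschRosenberg (f : ℂ → Nil3) (z : ℂ) : ℂ :=
  Complex.I / 4 * (hopf f z + phi f z 2 ^ 2 / Complex.I)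

/-- The support function `h = ⟨f⁻¹ L, e₃⟩`, with `L = e^{u/2} N`. -/
def support (f : ℂ → Nil3) (z : ℂ) : ℝ :=
  Real.sqrt (confFactor f z) * unitNormal f z 2

/-- `f` restricts to a smooth conformal immersion on `S` which is minimal (`H = 0`) and
nowhere vertical (`e₃` is nowhere tangent, i.e. `⟨f⁻¹ N, e₃⟩ ≠ 0`). -/
structure IsMinimalSurface (f : ℂ → Nil3) (S : Set ℂ) : Prop where
  smooth : ContDiffOn ℝ ∞ f S
  conformal : ∀ z ∈ S,
    nilMetric (f z) (fderiv ℝ f z 1) (fderiv ℝ f z 1)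
        = nilMetric (f z) (fderiv ℝ f z Complex.I) (fderiv ℝ f z Complex.I) ∧
      nilMetric (f z) (fderiv ℝ f z 1) (fderiv ℝ f z Complex.I) = 0
  immersed : ∀ z ∈ S, 0 < confFactor f z
  minimal : ∀ z ∈ S, meanCurvature f z = 0
  nonvertical : ∀ z ∈ S, unitNormal f z 2 ≠ 0

/-- The upward unit normal `± f⁻¹ N`. -/
def upwardNormal (f : ℂ → Nil3) (z : ℂ) : Fin 3 → ℝ :=
  if unitNormal f z 2 < 0 then -unitNormal f z else unitNormal f z

/-- The normal Gauss map: stereographic projection from the south pole of the upward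
unit normal; it takes values in the unit disk when the surface is nowhere vertical. -/
def gaussMap (f : ℂ → Nil3) (z : ℂ) : ℂ :=
  ((upwardNormal f z 0 : ℂ) + Complex.I * (upwardNormal f z 1 : ℂ))
    / (1 + (upwardNormal f z 2 : ℂ))

/-- `(ψ₁, ψ₂)` are values at `z` of generating spinors of `f`. -/
def IsSpinorAt (f : ℂ → Nil3) (z ψ₁ ψ₂ : ℂ) : Prop :=
  phi f z 0 = (starRingEnd ℂ ψ₂) ^ 2 - ψ₁ ^ 2 ∧
  phi f z 1 = Complex.I * ((starRingEnd ℂ ψ₂) ^ 2 + ψ₁ ^ 2) ∧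
  phi f z 2 = 2 * ψ₁ * starRingEnd ℂ ψ₂

/-- `fd` is a dual surface of the minimal surface `f` on `S`: it has generating spinors
`ψ₁* = (4 √(-B) / h) ψ₂` and `ψ₂* = (4 √(-B̄) / h) ψ₁`, where `√(-B̄)` is the conjugate
of `√(-B)`.  Since `f⁻¹ f_z` is quadratic in the spinors, the signs of the spinors and of
the root `s = √(-B)` are immaterial and can be chosen point by point. -/
def IsDual (f fd : ℂ → Nil3) (S : Set ℂ) : Prop :=
  ∀ z ∈ S, ∃ ψ₁ ψ₂ s : ℂ, IsSpinorAt f z ψ₁ ψ₂ ∧ s ^ 2 = -abreschRosenberg f z ∧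
    IsSpinorAt fd z (4 * s / (support f z : ℂ) * ψ₂)
      (4 * starRingEnd ℂ s / (support f z : ℂ) * ψ₁)

/-! ### The family of flat connections and extended frames -/

abbrev Mat2 : Type := Matrix (Fin 2) (Fin 2) ℂ

/-- The Wirtinger derivative `∂_z`. -/
def dz (g : ℂ → ℂ) (z : ℂ) : ℂ :=
  (fderiv ℝ g z 1 - Complex.I * fderiv ℝ g z Complex.I) / 2

/-- The Wirtinger derivative `∂_z̄`. -/
def dzbar (g : ℂ → ℂ) (z : ℂ) : ℂ :=
  (fderiv ℝ g z 1 + Complex.I * fderiv ℝ g z Complex.I) / 2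

/-- The function `w` for which `e^{w/2}` is the Dirac potential `i h / 4` of a minimal
surface. The principal branch is smooth here, as `i h / 4` is never a negative real. -/
def diracW (f : ℂ → Nil3) (z : ℂ) : ℂ :=
  2 * Complex.log (Complex.I / 4 * (support f z : ℂ))

/-- The `dz`-part `U^λ` of the Maurer-Cartan form `α^λ`. -/
def connU (f : ℂ → Nil3) (lam : Circle) (z : ℂ) : Mat2 :=
  !![dz (diracW f) z / 4, -(lam : ℂ)⁻¹ * Complex.exp (diracW f z / 2);
     (lam : ℂ)⁻¹ * abreschRosenberg f z * Complex.exp (-diracW f z / 2),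
     -dz (diracW f) z / 4]

/-- The `dz̄`-part `V^λ` of the Maurer-Cartan form `α^λ`. -/
def connV (f : ℂ → Nil3) (lam : Circle) (z : ℂ) : Mat2 :=
  !![-dzbar (diracW f) z / 4,
     -(lam : ℂ) * starRingEnd ℂ (abreschRosenberg f z) * Complex.exp (-diracW f z / 2);
     (lam : ℂ) * Complex.exp (diracW f z / 2), dzbar (diracW f) z / 4]

def sigma3 : Mat2 := !![1, 0; 0, -1]

/-- The group `SU(1,1)`. -/
def SU11 : Set Mat2 := {A | Aᴴ * sigma3 * A = sigma3 ∧ A.det = 1}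

/-- `F` is an extended frame of the minimal surface `f` on `D`: a smooth family of
`SU(1,1)`-valued solutions of `F⁻¹ dF = α^λ`, `λ ∈ S¹`. -/
structure IsExtendedFrame (f : ℂ → Nil3) (D : Set ℂ) (F : Circle → ℂ → Mat2) : Prop where
  smooth : ∀ i j, ContDiffOn ℝ ∞
    (fun p : ℝ × ℂ => F (Circle.exp p.1) p.2 i j) (Set.univ ×ˢ D)
  mem_SU11 : ∀ lam, ∀ z ∈ D, F lam z ∈ SU11
  deriv_z : ∀ lam, ∀ z ∈ D, ∀ i j,
    dz (fun w => F lam w i j) z = (F lam z * connU f lam z) i j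
  deriv_zbar : ∀ lam, ∀ z ∈ D, ∀ i j,
    dzbar (fun w => F lam w i j) z = (F lam z * connV f lam z) i j

/-- The fixed square root `e^{iπ/4}` of `i`. -/
def sqrtI : ℂ := Complex.exp (Complex.I * (Real.pi : ℂ) / 4)

/-- The frame determined by the values `ψ₁, ψ₂` of generating spinors. -/
def spinorFrame (ψ₁ ψ₂ : ℂ) : Mat2 :=
  ((Real.sqrt (‖ψ₁‖ ^ 2 - ‖ψ₂‖ ^ 2) : ℝ) : ℂ)⁻¹ •
    !![sqrtI⁻¹ * ψ₁, sqrtI⁻¹ * ψ₂;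
       sqrtI * starRingEnd ℂ ψ₂, sqrtI * starRingEnd ℂ ψ₁]

/-- The extended frame `F` is associated with generating spinors of `f`: at `λ = 1` it is
the frame determined by generating spinors `ψ₁, ψ₂` of `f`. -/
def IsSpinorNormalized (f : ℂ → Nil3) (D : Set ℂ) (F : Circle → ℂ → Mat2) : Prop :=
  ∃ ψ₁ ψ₂ : ℂ → ℂ, ∀ z ∈ D, IsSpinorAt f z (ψ₁ z) (ψ₂ z) ∧
    F 1 z = spinorFrame (ψ₁ z) (ψ₂ z)

/-! ### The Sym formula -/

/-- The entrywise logarithmic derivative `λ ∂_λ` along the unit circle: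
`λ ∂_λ = -i ∂_θ` for `λ = e^{iθ}`. -/
def lamDeriv (M : Circle → Mat2) (lam : Circle) : Mat2 :=
  Matrix.of fun i j => -Complex.I * deriv (fun θ : ℝ => M (Circle.exp θ * lam) i j) 0

/-- `N_m = (i/2) Ad(F) σ₃`. -/
def symN (F : Circle → ℂ → Mat2) (lam : Circle) (z : ℂ) : Mat2 :=
  (Complex.I / 2) • (F lam z * sigma3 * (F lam z)⁻¹)

/-- `-i λ (∂_λ F) F⁻¹ + ε N_m`, which is `m_+` for `ε = 1` and `m_-` for `ε = -1`. -/
def symM (ε : ℂ) (F : Circle → ℂ → Mat2) (lam : Circle) (z : ℂ) : Mat2 :=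
  -Complex.I • (lamDeriv (fun l => F l z) lam * (F lam z)⁻¹) + ε • symN F lam z

def offDiagPart (A : Mat2) : Mat2 := !![0, A 0 1; A 1 0, 0]

def diagPart (A : Mat2) : Mat2 := !![A 0 0, 0; 0, A 1 1]

/-- `m^o - (i/2) (λ ∂_λ m)^d` for `m = m_±`. -/
def symHat (ε : ℂ) (F : Circle → ℂ → Mat2) (lam : Circle) (z : ℂ) : Mat2 :=
  offDiagPart (symM ε F lam z)
    - (Complex.I / 2) • diagPart (lamDeriv (fun l => symM ε F l z) lam)

/-- The basis `ℰ₁, ℰ₂, ℰ₃` of `su(1,1)`. -/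
def suBasis : Fin 3 → Mat2 :=
  ![(1 / 2 : ℂ) • !![0, Complex.I; -Complex.I, 0],
    (1 / 2 : ℂ) • !![0, -1; -1, 0],
    (1 / 2 : ℂ) • !![-Complex.I, 0; 0, Complex.I]]

/-- The map `exp ∘ Ξ` from `su(1,1)` to the Heisenberg group; it reads off the coordinates
in the basis `ℰ₁, ℰ₂, ℰ₃`, because `exp (∑ xₖ eₖ) = (x₁, x₂, x₃)`. -/
def XiNil (X : Mat2) : Nil3 := ![2 * (X 0 1).im, -2 * (X 0 1).re, -2 * (X 0 0).im]

theorem XiNil_sum (x : Fin 3 → ℝ) : XiNil (∑ k, (x k : ℂ) • suBasis k) = x := by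
  funext k
  fin_cases k <;> simp [XiNil, suBasis, Fin.sum_univ_three] <;> ring

/-- Every element of the Lie algebra `su(1,1)` is a real combination of `ℰ₁, ℰ₂, ℰ₃`. -/
theorem sum_XiNil (X : Mat2) (h : Xᴴ * sigma3 + sigma3 * X = 0) (ht : X.trace = 0) :
    ∑ k, (XiNil X k : ℂ) • suBasis k = X := by
  have h00 := congrFun (congrFun h 0) 0
  have h01 := congrFun (congrFun h 0) 1
  simp [sigma3, Matrix.mul_apply, Matrix.vecMul, dotProduct, Fin.sum_univ_two] at h00 h01
  have hre : (X 0 0).re = 0 := by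
    have := congrArg Complex.re h00
    simp at this
    linarith
  have h11 : X 1 1 = -X 0 0 := by
    rw [Matrix.trace_fin_two] at ht
    linear_combination ht
  have h10 : X 1 0 = starRingEnd ℂ (X 0 1) := by
    have : starRingEnd ℂ (X 1 0) = X 0 1 := by linear_combination -h01
    rw [← this, Complex.conj_conj]
  ext i j
  fin_cases i <;> fin_cases j <;>
    apply Complex.ext <;>
    simp [XiNil, suBasis, Fin.sum_univ_three, h11, h10, hre] <;> ring

/-- The map `f_-^λ` of the Sym formula. -/
def symMinus (F : Circle → ℂ → Mat2) (lam : Circle) (z : ℂ) : Nil3 :=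
  XiNil (symHat (-1) F lam z)

/-- The map `f_+^λ` of the Sym formula. -/
def symPlus (F : Circle → ℂ → Mat2) (lam : Circle) (z : ℂ) : Nil3 :=
  XiNil (symHat 1 F lam z)

/-- The point of the hyperbolic plane
`{x₁ ℰ₁ + x₂ ℰ₂ + x₃ ℰ₃ : x₁² + x₂² - x₃² = -1, x₃ < 0}` in `su(1,1)` with Poincaré disk
coordinate `g`: here `x₂ - i x₁ = 2 g / (1 - |g|²)` and `-x₃ = (1 + |g|²) / (1 - |g|²)`. -/
def hyperbolicPoint (g : ℂ) : Mat2 :=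
  (Complex.I / (2 * (1 - (‖g‖ : ℂ) ^ 2))) •
    !![1 + (‖g‖ : ℂ) ^ 2, 2 * Complex.I * g;
       2 * Complex.I * starRingEnd ℂ g, -(1 + (‖g‖ : ℂ) ^ 2)]

/-- The half-turn about the `x₃`-axis. -/
def halfTurn (x : Nil3) : Nil3 := ![-x 0, -x 1, x 2]

end NilSurf

end

open NilSurf

/-!
# The Sym formula for minimal surfaces in the Heisenberg group

All the surfaces in question are described by *null data* `(c, A, C)`: functions with
`φ₁ = -i c (A² + C²)`, `φ₂ = -c (A² - C²)`, `φ₃ = 2 c A C`, which amounts to spinors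
`ψ₁ = √(ic) A`, `conj ψ₂ = √(-ic) C`.  Conformality, the unit normal, the support function and
the normal Gauss map are algebraic in these data, and `|A|² - |C|² = ± 1` is the sign of
the normal.  If the data satisfy Dirac-type equations, the surface is minimal and the
coefficient `B` is read off from them (`minimal_of_dirac`).  Duality is the involution
`(c, A, C) ↦ (-4 B / c, conj C, conj A)` (`HasNullData.dual`).

Let `(a, b)` be the first row of the frame at `λ = e^{it}`, and `κ = h / 4`.  Differentiating
the Sym formula in `z` with the help of `F⁻¹ dF = α^λ`, one finds that `f_-^λ` has null data
`(2 λ⁻¹ κ, a, conj b)` and `f_+^λ` has null data `(-2 λ⁻¹ B / κ, b, conj a)`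
(`IsFrameRow.hasNullData_minus`, `IsFrameRow.hasNullData_plus`).  Both satisfy the Dirac
equations with coefficient `λ⁻² B`, and they are exchanged by the duality involution, since
`|c|² = 4 κ²` for the first.

No regularity of `h` and `B` beyond that of the frame is needed: `F⁻¹ F_z̄` and `F⁻¹ F_z` express
`h` and `B` through `F`, and `B` is holomorphic by the flatness of `α^λ`, that is, by
`∂_z ∂_z̄ F = ∂_z̄ ∂_z F` (`hasWirtinger_abreschRosenberg`); hence its zeros are isolated.
At `λ = 1`, a frame built from generating spinors gives `f` and `f_-` the same null data, so that
they differ by a left translation (`exists_leftTranslation`).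
-/

open scoped ContDiff Matrix Topology

noncomputable section

namespace NilSurf

open scoped ComplexConjugate

/-! ### Pointwise geometry of a surface with given Maurer-Cartan coefficients -/

/-- The Maurer-Cartan coefficients of `f` at `z` are the null vector with parameters `c`, `A`,
`C`. Generating spinors correspond to `ψ₁² = i c A²`, `conj ψ₂² = -i c C²`, `ψ₁ conj ψ₂ = c A C`;
keeping the factor `c` separate avoids square roots. -/
def HasNullData (f : ℂ → Nil3) (z c A C : ℂ) : Prop :=
  phi f z 0 = -Complex.I * c * (A ^ 2 + C ^ 2) ∧ phi f z 1 = -c * (A ^ 2 - C ^ 2) ∧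
    phi f z 2 = 2 * c * A * C

theorem mcForm_one (f : ℂ → Nil3) (z : ℂ) (k : Fin 3) :
    mcForm f 1 z k = 2 * (phi f z k).re := by
  simp [phi]
  ring

theorem mcForm_I (f : ℂ → Nil3) (z : ℂ) (k : Fin 3) :
    mcForm f Complex.I z k = -2 * (phi f z k).im := by
  simp [phi]
  ring

/-- The squared conformal factor is the square of `2 |c| (|A|² + |C|²)`. -/
theorem HasNullData.confFactor_eq {f : ℂ → Nil3} {z c A C : ℂ} (h : HasNullData f z c A C) :
    confFactor f z = (2 * ‖c‖ * (Complex.normSq A + Complex.normSq C)) ^ 2 := by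
  obtain ⟨h0, h1, h2⟩ := h
  have : confFactor f z = mcForm f 1 z ⬝ᵥ mcForm f 1 z := nilMetric_eq _ _ _
  rw [this, mul_pow, mul_pow, ← Complex.normSq_eq_norm_sq]
  simp only [dotProduct, Fin.sum_univ_three, mcForm_one, h0, h1, h2]
  simp [Complex.normSq_apply, pow_two]
  ring

/-- The unit normal depends on `A`, `C` only. At `A = C = 0` both sides vanish, by the convention
for division by zero. -/
theorem HasNullData.unitNormal_eq {f : ℂ → Nil3} {z c A C : ℂ} (h : HasNullData f z c A C)
    (hc : c ≠ 0) :
    unitNormal f z = (Complex.normSq A + Complex.normSq C)⁻¹ •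
      ![-2 * (A * conj C).im, 2 * (A * conj C).re, Complex.normSq A - Complex.normSq C] := by
  obtain ⟨h0, h1, h2⟩ := h
  set σ := Complex.normSq A + Complex.normSq C with hσ
  set n : Fin 3 → ℝ :=
    ![-2 * (A * conj C).im, 2 * (A * conj C).re, Complex.normSq A - Complex.normSq C] with hn
  have hσ0 : 0 ≤ σ := add_nonneg (Complex.normSq_nonneg _) (Complex.normSq_nonneg _)
  have hcross : crossProduct (mcForm f 1 z) (mcForm f Complex.I z)
      = (4 * Complex.normSq c * σ) • n := by
    funext i
    fin_cases i <;>
      simp [cross_apply, mcForm_one, mcForm_I, h0, h1, h2, hn, hσ, Complex.normSq_apply, pow_two,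
        -Complex.ofReal_mul] <;> ring
  have hnn : n ⬝ᵥ n = σ ^ 2 := by
    simp [dotProduct, Fin.sum_univ_three, hn, hσ, Complex.normSq_apply]
    ring
  have hK : 0 ≤ 4 * Complex.normSq c * σ * σ := by
    have := Complex.normSq_nonneg c
    positivity
  have hc' : Complex.normSq c ≠ 0 := by simpa using hc
  have hs : (4 * Complex.normSq c * σ) • n ⬝ᵥ (4 * Complex.normSq c * σ) • n
      = (4 * Complex.normSq c * σ * σ) ^ 2 := by
    rw [smul_dotProduct, dotProduct_smul, hnn]
    simp only [smul_eq_mul]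
    ring
  unfold unitNormal
  simp only [hcross, hs, Real.sqrt_sq hK, smul_smul]
  congr 1
  by_cases h0 : σ = 0
  · simp [h0]
  · field_simp

theorem HasNullData.support_eq {f : ℂ → Nil3} {z c A C : ℂ} (h : HasNullData f z c A C)
    (hc : c ≠ 0) :
    support f z = 2 * ‖c‖ * (Complex.normSq A - Complex.normSq C) := by
  have hA := Complex.normSq_nonneg A
  have hC := Complex.normSq_nonneg C
  unfold support
  rw [h.confFactor_eq, h.unitNormal_eq hc, Real.sqrt_sq (by positivity)]
  simp only [Pi.smul_apply, smul_eq_mul, Matrix.cons_val]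
  by_cases h0 : Complex.normSq A + Complex.normSq C = 0
  · have : Complex.normSq A - Complex.normSq C = 0 := by linarith
    simp [this]
  · field_simp

theorem HasNullData.conformal {f : ℂ → Nil3} {z c A C : ℂ} (h : HasNullData f z c A C) :
    nilMetric (f z) (fderiv ℝ f z 1) (fderiv ℝ f z 1)
        = nilMetric (f z) (fderiv ℝ f z Complex.I) (fderiv ℝ f z Complex.I) ∧
      nilMetric (f z) (fderiv ℝ f z 1) (fderiv ℝ f z Complex.I) = 0 := by
  obtain ⟨h0, h1, h2⟩ := h
  simp only [nilMetric_eq]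
  change mcForm f 1 z ⬝ᵥ mcForm f 1 z = mcForm f Complex.I z ⬝ᵥ mcForm f Complex.I z ∧
    mcForm f 1 z ⬝ᵥ mcForm f Complex.I z = 0
  simp only [dotProduct, Fin.sum_univ_three, mcForm_one, mcForm_I, h0, h1, h2]
  constructor <;> simp [pow_two] <;> ring

/-- Spinors are null data with `c = -i`. -/
theorem hasNullData_of_isSpinorAt {f : ℂ → Nil3} {z ψ₁ ψ₂ : ℂ} (h : IsSpinorAt f z ψ₁ ψ₂) :
    HasNullData f z (-Complex.I) ψ₁ (Complex.I * conj ψ₂) := by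
  obtain ⟨h0, h1, h2⟩ := h
  refine ⟨?_, ?_, ?_⟩
  · rw [h0]; linear_combination
      (-ψ₁ ^ 2 - Complex.I ^ 2 * conj ψ₂ ^ 2 + conj ψ₂ ^ 2) * Complex.I_sq
  · rw [h1]; linear_combination Complex.I * conj ψ₂ ^ 2 * Complex.I_sq
  · rw [h2]; linear_combination 2 * ψ₁ * conj ψ₂ * Complex.I_sq

/-- Passing to the dual surface replaces `(c, A, C)` by `(-4 B / c, conj C, conj A)`; the
condition on `|A|² - |C|²` normalises the support function to `± 2 |c|`. -/
theorem HasNullData.dual {f fd : ℂ → Nil3} {z c A C B : ℂ} (h : HasNullData f z c A C)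
    (hc : c ≠ 0) (hδ : (Complex.normSq A - Complex.normSq C) ^ 2 = 1)
    (hB : abreschRosenberg f z = B)
    (hd : HasNullData fd z (-4 * B / c) (conj C) (conj A)) :
    ∃ ψ₁ ψ₂ s : ℂ, IsSpinorAt f z ψ₁ ψ₂ ∧ s ^ 2 = -abreschRosenberg f z ∧
      IsSpinorAt fd z (4 * s / (support f z : ℂ) * ψ₂)
        (4 * starRingEnd ℂ s / (support f z : ℂ) * ψ₁) := by
  obtain ⟨d, hd2⟩ := IsAlgClosed.exists_pow_nat_eq (Complex.I * c) (n := 2) (by norm_num)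
  obtain ⟨s, hs⟩ := IsAlgClosed.exists_pow_nat_eq (-B) (n := 2) (by norm_num)
  have hdc : conj d ^ 2 = -Complex.I * conj c := by
    rw [← map_pow, hd2]; simp
  have hsup : ((support f z : ℝ) : ℂ) ^ 2 = 4 * (c * conj c) := by
    rw [h.support_eq hc, Complex.mul_conj, Complex.normSq_eq_norm_sq c,
      ← Complex.ofReal_pow, mul_pow, hδ]
    push_cast
    ring
  have hcc : conj c ≠ 0 := by simpa using hc
  have hs0 : ((support f z : ℝ) : ℂ) ≠ 0 := by
    intro h0
    rw [h0] at hsup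
    simp [hc] at hsup
  -- every coefficient of the dual surface carries the factor `16 s² / h²`
  have key : 16 * s ^ 2 / ((support f z : ℝ) : ℂ) ^ 2 = -4 * B / (c * conj c) := by
    rw [hsup, hs]; field_simp; ring
  refine ⟨d * A, conj (-Complex.I * d * C), s, ?_, by rw [hs, hB], ?_⟩
  · obtain ⟨h0, h1, h2⟩ := h
    refine ⟨?_, ?_, ?_⟩
    · rw [h0, Complex.conj_conj]
      linear_combination (A ^ 2 + C ^ 2) * hd2 - d ^ 2 * C ^ 2 * Complex.I_sq
    · rw [h1, Complex.conj_conj]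
      linear_combination (Complex.I * C ^ 2 - Complex.I * A ^ 2) * hd2
        - Complex.I * d ^ 2 * C ^ 2 * Complex.I_sq + c * (C ^ 2 - A ^ 2) * Complex.I_sq
    · rw [h2, Complex.conj_conj]
      linear_combination 2 * Complex.I * A * C * hd2 + 2 * A * C * c * Complex.I_sq
  · obtain ⟨h0, h1, h2⟩ := hd
    have e : -4 * B / c = -4 * B / (c * conj c) * conj c := by field_simp
    rw [e] at h0 h1 h2
    rw [← key] at h0 h1 h2
    refine ⟨?_, ?_, ?_⟩
    · rw [h0]
      simp only [map_mul, map_div₀, map_neg, Complex.conj_conj, Complex.conj_ofReal, Complex.conj_I,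
        map_ofNat]
      field_simp
      linear_combination 16 * s ^ 2 * (-(conj A) ^ 2 - conj C ^ 2) * hdc
        + 16 * s ^ 2 * conj C ^ 2 * conj d ^ 2 * Complex.I_sq
    · rw [h1]
      simp only [map_mul, map_div₀, map_neg, Complex.conj_conj, Complex.conj_ofReal, Complex.conj_I,
        map_ofNat]
      field_simp
      linear_combination
        16 * s ^ 2 * (-Complex.I * (conj A) ^ 2 + Complex.I * conj C ^ 2) * hdc
        + 16 * s ^ 2 * (conj c * conj A ^ 2 - conj c * conj C ^ 2
          - Complex.I * conj d ^ 2 * conj C ^ 2) * Complex.I_sq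
    · rw [h2]
      simp only [map_mul, map_div₀, map_neg, Complex.conj_conj, Complex.conj_ofReal, Complex.conj_I,
        map_ofNat]
      field_simp
      linear_combination -16 * s ^ 2 * conj C * conj A * Complex.I * hdc
        + 16 * s ^ 2 * conj C * conj A * conj c * Complex.I_sq

/-! ### Wirtinger calculus -/

/-- The real-linear map `v ↦ p v + q conj v`. -/
def wirtingerCLM (p q : ℂ) : ℂ →L[ℝ] ℂ :=
  p • ContinuousLinearMap.id ℝ ℂ + q • (Complex.conjCLE : ℂ →L[ℝ] ℂ)

@[simp] theorem wirtingerCLM_apply (p q v : ℂ) : wirtingerCLM p q v = p * v + q * conj v := by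
  simp [wirtingerCLM]

/-- `g` is real differentiable at `z`, with `∂_z g = p` and `∂_z̄ g = q`. -/
def HasWirtinger (g : ℂ → ℂ) (p q z : ℂ) : Prop :=
  HasFDerivAt (𝕜 := ℝ) g (wirtingerCLM p q) z

namespace HasWirtinger

variable {g h : ℂ → ℂ} {p q p' q' z : ℂ}

theorem dz_eq (hg : HasWirtinger g p q z) : dz g z = p := by
  rw [dz, HasFDerivAt.fderiv hg]
  simp
  linear_combination (-p / 2 + q / 2) * Complex.I_sq

theorem dzbar_eq (hg : HasWirtinger g p q z) : dzbar g z = q := by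
  rw [dzbar, HasFDerivAt.fderiv hg]
  simp
  linear_combination (p / 2 - q / 2) * Complex.I_sq

theorem _root_.DifferentiableAt.hasWirtinger (hg : DifferentiableAt ℝ g z) :
    HasWirtinger g (dz g z) (dzbar g z) z := by
  have : fderiv ℝ g z = wirtingerCLM (dz g z) (dzbar g z) := by
    ext v
    obtain ⟨x, y, rfl⟩ : ∃ x y : ℝ, v = x • (1 : ℂ) + y • Complex.I :=
      ⟨v.re, v.im, by apply Complex.ext <;> simp⟩
    rw [map_add, map_smul, map_smul, wirtingerCLM_apply, dz, dzbar]
    simp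
    linear_combination ((y : ℂ) * fderiv ℝ g z Complex.I) * Complex.I_sq
  rw [HasWirtinger, ← this]
  exact hg.hasFDerivAt

theorem congr_deriv (hg : HasWirtinger g p q z) (hp : p = p') (hq : q = q') :
    HasWirtinger g p' q' z := by rwa [← hp, ← hq]

theorem congr_of_eventuallyEq (hg : HasWirtinger g p q z) (e : h =ᶠ[𝓝 z] g) :
    HasWirtinger h p q z :=
  HasFDerivAt.congr_of_eventuallyEq hg e

theorem mul (hg : HasWirtinger g p q z) (hh : HasWirtinger h p' q' z) :
    HasWirtinger (fun w => g w * h w) (p * h z + g z * p') (q * h z + g z * q') z := by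
  refine (HasFDerivAt.mul hg hh).congr_fderiv ?_
  ext v
  simp
  ring

theorem add (hg : HasWirtinger g p q z) (hh : HasWirtinger h p' q' z) :
    HasWirtinger (fun w => g w + h w) (p + p') (q + q') z := by
  refine (HasFDerivAt.add hg hh).congr_fderiv ?_
  ext v
  simp
  ring

theorem sub (hg : HasWirtinger g p q z) (hh : HasWirtinger h p' q' z) :
    HasWirtinger (fun w => g w - h w) (p - p') (q - q') z := by
  refine (HasFDerivAt.sub hg hh).congr_fderiv ?_
  ext v
  simp
  ring

theorem const_mul (a : ℂ) (hg : HasWirtinger g p q z) :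
    HasWirtinger (fun w => a * g w) (a * p) (a * q) z := by
  refine (HasFDerivAt.const_mul hg a).congr_fderiv ?_
  ext v
  simp
  ring

theorem conj_comp (hg : HasWirtinger g p q z) :
    HasWirtinger (fun w => conj (g w)) (conj q) (conj p) z := by
  refine ((Complex.conjCLE : ℂ →L[ℝ] ℂ).hasFDerivAt.comp z hg).congr_fderiv ?_
  ext v
  simp
  ring

theorem inv (hg : HasWirtinger g p q z) (h0 : g z ≠ 0) :
    HasWirtinger (fun w => (g w)⁻¹) (-p / g z ^ 2) (-q / g z ^ 2) z := by
  refine ((hasFDerivAt_inv' (𝕜 := ℝ) h0).comp z hg).congr_fderiv ?_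
  ext v
  simp
  field_simp
  ring

end HasWirtinger

/-! ### Mean curvature and Hopf differential from the Maurer-Cartan coefficients -/

section curvature

variable {f : ℂ → Nil3} {z : ℂ} {P R : Fin 3 → ℂ}

theorem fderiv_mcForm_one (h : ∀ k, HasWirtinger (fun w => phi f w k) (P k) (R k) z)
    (a : ℂ) (k : Fin 3) :
    fderiv ℝ (fun w => mcForm f 1 w) z a k = 2 * (P k * a + R k * conj a).re := by
  have : HasFDerivAt (fun w => mcForm f 1 w)
      (ContinuousLinearMap.pi fun k => (2 : ℝ) • Complex.reCLM.comp (wirtingerCLM (P k) (R k)))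
      z := by
    rw [hasFDerivAt_pi]
    intro k
    simp only [mcForm_one]
    exact (Complex.reCLM.hasFDerivAt.comp z (h k)).const_mul 2
  rw [this.fderiv]
  simp

theorem fderiv_mcForm_I (h : ∀ k, HasWirtinger (fun w => phi f w k) (P k) (R k) z)
    (a : ℂ) (k : Fin 3) :
    fderiv ℝ (fun w => mcForm f Complex.I w) z a k = -2 * (P k * a + R k * conj a).im := by
  have : HasFDerivAt (fun w => mcForm f Complex.I w)
      (ContinuousLinearMap.pi fun k => (-2 : ℝ) • Complex.imCLM.comp (wirtingerCLM (P k) (R k)))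
      z := by
    rw [hasFDerivAt_pi]
    intro k
    simp only [mcForm_I]
    exact (Complex.imCLM.hasFDerivAt.comp z (h k)).const_mul (-2)
  rw [this.fderiv]
  simp

/-- The numerator of the mean curvature, from `P = ∂_z φ` and `R = ∂_z̄ φ`. -/
theorem secondForm_trace (h : ∀ k, HasWirtinger (fun w => phi f w k) (P k) (R k) z) :
    secondForm f 1 1 z + secondForm f Complex.I Complex.I z =
      4 * ((∑ k, unitNormal f z k * (R k).re)
        + unitNormal f z 0 * (phi f z 1 * conj (phi f z 2)).re
        - unitNormal f z 1 * (phi f z 0 * conj (phi f z 2)).re) := by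
  simp only [secondForm, covDeriv, dotProduct, Fin.sum_univ_three, Pi.add_apply,
    fderiv_mcForm_one h, fderiv_mcForm_I h]
  simp [nilConn, mcForm_one, mcForm_I]
  ring

/-- The Hopf differential; the terms with `Im R` and `Im (conj φ₁ φ₂)` come from the antisymmetric
part of `∇_x f_y` and cancel each other by the structure equation. -/
theorem hopf_eq (h : ∀ k, HasWirtinger (fun w => phi f w k) (P k) (R k) z) :
    hopf f z = (∑ k, (unitNormal f z k : ℂ) * (P k + Complex.I * (R k).im))
        + unitNormal f z 0 * (phi f z 1 * phi f z 2)
        - unitNormal f z 1 * (phi f z 0 * phi f z 2)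
        + unitNormal f z 2 * (Complex.I * (conj (phi f z 0) * phi f z 1).im) := by
  simp only [hopf, secondForm, covDeriv, dotProduct, Fin.sum_univ_three, Pi.add_apply,
    fderiv_mcForm_one h, fderiv_mcForm_I h]
  apply Complex.ext <;> simp [nilConn, mcForm_one, mcForm_I] <;> ring

end curvature

/-- A surface whose null data satisfy these Dirac-type equations has `H = 0`, and the coefficient
of its Abresch-Rosenberg differential can be read off.  The gauge terms drop out: `v` cancels in
`∂_z̄ φ`, and `u` multiplies the complex tangent vector, which is orthogonal to `N`. -/
theorem minimal_of_dirac {f : ℂ → Nil3} {z : ℂ} {c A C : ℂ → ℂ} {u v q s c' B : ℂ} {δ : ℝ}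
    (h : ∀ᶠ w in 𝓝 z, HasNullData f w (c w) (A w) (C w)) (hc0 : c z ≠ 0)
    (hδ : Complex.normSq (A z) - Complex.normSq (C z) = δ) (hδ2 : δ ^ 2 = 1)
    (hc : HasWirtinger c c' (-2 * v * c z) z)
    (hA : HasWirtinger A (u * A z + q * conj (C z)) (v * A z + s * conj (C z)) z)
    (hC : HasWirtinger C (u * C z + q * conj (A z)) (v * C z + s * conj (A z)) z)
    (hs : c z * s = Complex.I / 2 * (c z * conj (c z)) * δ)
    (hq : c z * q = -2 * Complex.I * B * δ) :
    meanCurvature f z = 0 ∧ abreschRosenberg f z = B := by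
  have hz := h.self_of_nhds
  have hN := hz.unitNormal_eq hc0
  obtain ⟨h0, h1, h2⟩ := hz
  set μ := c' + 2 * u * c z with hμ
  set a := A z with ha
  set b := C z with hb
  set σ := Complex.normSq a + Complex.normSq b with hσ
  have hna : (Complex.normSq a : ℂ) = a * conj a := (Complex.mul_conj a).symm
  have hnb : (Complex.normSq b : ℂ) = b * conj b := (Complex.mul_conj b).symm
  have hσ0 : σ ≠ 0 := by
    intro h
    have h1 := Complex.normSq_nonneg a
    have h2 := Complex.normSq_nonneg b
    have : δ = 0 := by rw [← hδ]; linarith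
    simp [this] at hδ2
  have key : ∀ k, HasWirtinger (fun w => phi f w k)
      ((![-Complex.I * (μ * (a ^ 2 + b ^ 2)) - 8 * B * δ * (a * conj b).re,
        -(μ * (a ^ 2 - b ^ 2)) - 8 * B * δ * (a * conj b).im,
        2 * (μ * (a * b)) - 4 * Complex.I * B * δ * σ] : Fin 3 → ℂ) k)
      ((![((Complex.normSq (c z) * δ * (2 * (a * conj b).re) : ℝ) : ℂ),
        ((Complex.normSq (c z) * δ * (2 * (a * conj b).im) : ℝ) : ℂ),
        Complex.I * ((Complex.normSq (c z) * δ * σ : ℝ) : ℂ)] : Fin 3 → ℂ) k) z := by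
    have hre : ((a * conj b).re : ℂ) = (a * conj b + conj a * b) / 2 := by
      rw [Complex.re_eq_add_conj]; simp
    have him : ((a * conj b).im : ℂ) = (a * conj b - conj a * b) / (2 * Complex.I) := by
      rw [Complex.im_eq_sub_conj]; simp
    have him' : ((a * conj b).im : ℂ) = -Complex.I * (a * conj b - conj a * b) / 2 := by
      rw [him]; field_simp; simp
    have hncc : (Complex.normSq (c z) : ℂ) = c z * conj (c z) := (Complex.mul_conj _).symm
    have hσc : (σ : ℂ) = a * conj a + b * conj b := by rw [hσ]; push_cast; rw [hna, hnb]
    intro k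
    fin_cases k
    · refine ((((hA.mul hA).add (hC.mul hC)).const_mul (-Complex.I)).mul
        hc).congr_of_eventuallyEq ?_ |>.congr_deriv ?_ ?_
      · filter_upwards [h] with w hw
        simp only [Fin.zero_eta]
        rw [hw.1]; ring
      · simp only [Fin.zero_eta, Matrix.cons_val_zero, hre]
        linear_combination (-Complex.I * 2 * (a * conj b + b * conj a)) * hq
          + 4 * B * δ * (a * conj b + conj a * b) * Complex.I_sq
      · simp only [Fin.zero_eta, Matrix.cons_val_zero]
        push_cast
        rw [hre, hncc]
        linear_combination (-Complex.I * 2 * (a * conj b + b * conj a)) * hs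
          - (c z * conj (c z)) * δ * (a * conj b + conj a * b) * Complex.I_sq
    · refine ((((hA.mul hA).sub (hC.mul hC)).const_mul (-1)).mul
        hc).congr_of_eventuallyEq ?_ |>.congr_deriv ?_ ?_
      · filter_upwards [h] with w hw
        simp only [Fin.mk_one]
        rw [hw.2.1]; ring
      · simp only [Fin.mk_one, Matrix.cons_val_one, Matrix.cons_val_zero, him']
        linear_combination (-2 * (a * conj b - b * conj a)) * hq
      · simp only [Fin.mk_one, Matrix.cons_val_one, Matrix.cons_val_zero]
        push_cast
        rw [him', hncc]
        linear_combination (-2 * (a * conj b - b * conj a)) * hs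
    · refine (((hA.mul hC).const_mul 2).mul
        hc).congr_of_eventuallyEq ?_ |>.congr_deriv ?_ ?_
      · filter_upwards [h] with w hw
        simp only [Fin.reduceFinMk]
        rw [hw.2.2]; ring
      · simp only [Fin.reduceFinMk, Matrix.cons_val]
        rw [hσc]
        linear_combination (2 * (a * conj a + b * conj b)) * hq
      · simp only [Fin.reduceFinMk, Matrix.cons_val]
        push_cast
        rw [hσc, hncc]
        linear_combination (2 * (a * conj a + b * conj b)) * hs
  constructor
  · have : secondForm f 1 1 z + secondForm f Complex.I Complex.I z = 0 := by
      rw [secondForm_trace key, hN, h0, h1, h2]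
      simp [Fin.sum_univ_three, -Complex.mul_re, pow_two]
      simp
      ring
    rw [meanCurvature, this, zero_div]
  · rw [abreschRosenberg, hopf_eq key, hN, h0, h1, h2]
    have him : (conj (-Complex.I * c z * (a ^ 2 + b ^ 2)) * (-c z * (a ^ 2 - b ^ 2))).im
        = -(Complex.normSq (c z) * σ * δ) := by
      rw [hσ, ← hδ]
      simp [Complex.normSq_apply, pow_two]
      ring
    rw [him]
    set ρ := (a * conj b).re with hρ
    set ι := (a * conj b).im with hι
    have e1 : a * conj b = ρ + ι * Complex.I := (Complex.re_add_im _).symm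
    have e2 : conj a * b = ρ - ι * Complex.I := by
      have := congrArg conj e1
      simpa [sub_eq_add_neg] using this
    have hσc : (σ : ℂ) = a * conj a + b * conj b := by rw [hσ]; push_cast; rw [hna, hnb]
    have hσc0 : (σ : ℂ) ≠ 0 := by exact_mod_cast hσ0
    have hδc : (δ : ℂ) ^ 2 = 1 := by exact_mod_cast hδ2
    have hδ' : Complex.normSq a - Complex.normSq b = δ := hδ
    simp only [Fin.sum_univ_three, Pi.smul_apply, smul_eq_mul, Matrix.cons_val, hδ']
    simp
    have hδn : (δ : ℂ) = a * conj a - b * conj b := by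
      rw [← hδ']; push_cast; rw [hna, hnb]
    field_simp
    linear_combination
      Complex.I * 2 * μ * (a ^ 2 * e2 - b ^ 2 * e1 + a * b * hδn)
      - 4 * Complex.I ^ 2 * a * b * c z ^ 2 * (a ^ 2 * e2 + b ^ 2 * e1)
      - 4 * Complex.I ^ 2 * a ^ 2 * b ^ 2 * c z ^ 2 * hσc
      + (Complex.I * 4 * a * b * c z ^ 2 * (a ^ 2 - b ^ 2) * ι - 4 * σ * B * δ ^ 2)
        * Complex.I_sq
      + 4 * σ * B * hδc

/-! ### Differentiation in the spectral parameter -/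

theorem contDiffOn_conj {E : Type*} [NormedAddCommGroup E] [NormedSpace ℝ E] {g : E → ℂ}
    {s : Set E} (hg : ContDiffOn ℝ ∞ g s) : ContDiffOn ℝ ∞ (fun x => conj (g x)) s :=
  (Complex.conjCLE : ℂ →L[ℝ] ℂ).contDiff.comp_contDiffOn hg

section parameter

variable {D : Set ℂ} {g : ℝ → ℂ → ℂ}

theorem contDiffAt_of_univ_prod (hD : IsOpen D)
    (hg : ContDiffOn ℝ ∞ (fun p : ℝ × ℂ => g p.1 p.2) (Set.univ ×ˢ D)) {z : ℂ} (hz : z ∈ D)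
    (t : ℝ) : ContDiffAt ℝ ∞ (fun p : ℝ × ℂ => g p.1 p.2) (t, z) :=
  hg.contDiffAt ((isOpen_univ.prod hD).mem_nhds ⟨trivial, hz⟩)

theorem deriv_param_eq (hD : IsOpen D)
    (hg : ContDiffOn ℝ ∞ (fun p : ℝ × ℂ => g p.1 p.2) (Set.univ ×ˢ D)) {z : ℂ} (hz : z ∈ D)
    (t : ℝ) : HasDerivAt (fun τ => g τ z)
      (fderiv ℝ (fun p : ℝ × ℂ => g p.1 p.2) (t, z) (1, 0)) t := by
  have h1 : HasFDerivAt (fun p : ℝ × ℂ => g p.1 p.2) _ (t, z) :=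
    ((contDiffAt_of_univ_prod hD hg hz t).differentiableAt (by simp)).hasFDerivAt
  have h2 : HasDerivAt (fun τ : ℝ => (τ, z)) (1, 0) t :=
    (hasDerivAt_id t).prodMk (hasDerivAt_const t z)
  exact h1.comp_hasDerivAt t h2

theorem contDiffOn_deriv_param (hD : IsOpen D)
    (hg : ContDiffOn ℝ ∞ (fun p : ℝ × ℂ => g p.1 p.2) (Set.univ ×ˢ D)) :
    ContDiffOn ℝ ∞ (fun p : ℝ × ℂ => deriv (fun τ => g τ p.2) p.1) (Set.univ ×ˢ D) := by
  have h1 : ContDiffOn ℝ ∞ (fun p => fderiv ℝ (fun p : ℝ × ℂ => g p.1 p.2) p (1, 0))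
      (Set.univ ×ˢ D) :=
    (hg.fderiv_of_isOpen (isOpen_univ.prod hD) (by simp)).clm_apply contDiffOn_const
  exact h1.congr fun p hp => (deriv_param_eq hD hg hp.2 p.1).deriv

/-- `∂_z` and `∂_z̄` commute with the derivative in the real parameter. -/
theorem HasWirtinger.deriv_param (hD : IsOpen D)
    (hg : ContDiffOn ℝ ∞ (fun p : ℝ × ℂ => g p.1 p.2) (Set.univ ×ˢ D)) {z : ℂ} (hz : z ∈ D)
    {t : ℝ} {P Q : ℝ → ℂ} {P' Q' : ℂ} (h : ∀ τ, HasWirtinger (g τ) (P τ) (Q τ) z)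
    (hP : HasDerivAt P P' t) (hQ : HasDerivAt Q Q' t) :
    HasWirtinger (fun w => deriv (fun τ => g τ w) t) P' Q' z := by
  set G : ℝ × ℂ → ℂ := fun p => g p.1 p.2 with hG
  have hc := contDiffAt_of_univ_prod hD hg hz t
  have hd : HasFDerivAt (fderiv ℝ G) (fderiv ℝ (fderiv ℝ G) (t, z)) (t, z) :=
    ((hc.fderiv_right (m := ∞) (by simp)).differentiableAt (by simp)).hasFDerivAt
  have hsymm : IsSymmSndFDerivAt ℝ G (t, z) := hc.isSymmSndFDerivAt (by
    rw [minSmoothness_of_isRCLikeNormedField]; exact WithTop.coe_le_coe.2 le_top)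
  have h1 : HasFDerivAt (fun w : ℂ => ((t, w) : ℝ × ℂ)) (ContinuousLinearMap.inr ℝ ℝ ℂ) z :=
    hasFDerivAt_prodMk_right t z
  have h2 : HasFDerivAt (fun w : ℂ => fderiv ℝ G (t, w)) _ z := hd.comp z h1
  have h3 := ((ContinuousLinearMap.apply ℝ ℂ ((1, 0) : ℝ × ℂ)).hasFDerivAt).comp z h2
  have h4 : (fun w => deriv (fun τ => g τ w) t) =ᶠ[𝓝 z]
      (ContinuousLinearMap.apply ℝ ℂ ((1, 0) : ℝ × ℂ)) ∘ fun w : ℂ => fderiv ℝ G (t, w) := by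
    filter_upwards [hD.mem_nhds hz] with w hw
    exact (deriv_param_eq hD hg hw t).deriv
  refine (h3.congr_of_eventuallyEq h4).congr_fderiv ?_
  ext v
  have h5 : HasDerivAt (fun τ : ℝ => ((τ, z) : ℝ × ℂ)) (1, 0) t :=
    (hasDerivAt_id t).prodMk (hasDerivAt_const t z)
  have h6 := ((ContinuousLinearMap.apply ℝ ℂ ((0, v) : ℝ × ℂ)).hasFDerivAt).comp_hasDerivAt t
    (hd.comp_hasDerivAt t h5)
  have h7 : (fun τ => P τ * v + Q τ * conj v)
      = (ContinuousLinearMap.apply ℝ ℂ ((0, v) : ℝ × ℂ)) ∘ fun τ => fderiv ℝ G (τ, z) := by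
    funext τ
    have h8 : HasFDerivAt (fun w : ℂ => G (τ, w)) _ z :=
      ((contDiffAt_of_univ_prod hD hg hz τ).differentiableAt (by simp)).hasFDerivAt.comp z
        (hasFDerivAt_prodMk_right τ z)
    have := congrArg (fun L : ℂ →L[ℝ] ℂ => L v) (HasFDerivAt.unique (h τ) h8)
    simpa using this
  have h9 : HasDerivAt (fun τ => P τ * v + Q τ * conj v) (P' * v + Q' * conj v) t :=
    (hP.mul_const v).add (hQ.mul_const (conj v))
  rw [h7] at h9
  have h10 := h9.unique h6
  simp only [wirtingerCLM_apply]
  rw [h10]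
  exact hsymm.eq _ _

end parameter

/-- Maurer-Cartan coefficients of a surface given by two complex functions `ξ = x₁ + i x₂` and
`y` with imaginary part `x₃`. -/
theorem phi_of_hasWirtinger {f : ℂ → Nil3} {ξ y : ℂ → ℂ} {z ξ₁ ξ₂ y₁ y₂ : ℂ}
    (hf : ∀ᶠ w in 𝓝 z, f w = ![(ξ w).re, (ξ w).im, (y w).im])
    (hξ : HasWirtinger ξ ξ₁ ξ₂ z) (hy : HasWirtinger y y₁ y₂ z) :
    phi f z 0 = (ξ₁ + conj ξ₂) / 2 ∧ phi f z 1 = -Complex.I * (ξ₁ - conj ξ₂) / 2 ∧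
      phi f z 2 = -Complex.I * (y₁ - conj y₂) / 2
        - Complex.I / 4 * (ξ z * conj ξ₂ - conj (ξ z) * ξ₁) := by
  have hd : HasFDerivAt f (ContinuousLinearMap.pi
      ![Complex.reCLM.comp (wirtingerCLM ξ₁ ξ₂), Complex.imCLM.comp (wirtingerCLM ξ₁ ξ₂),
        Complex.imCLM.comp (wirtingerCLM y₁ y₂)]) z := by
    have h0 : HasFDerivAt (fun w => (![(ξ w).re, (ξ w).im, (y w).im] : Nil3))
        (ContinuousLinearMap.pi
          ![Complex.reCLM.comp (wirtingerCLM ξ₁ ξ₂), Complex.imCLM.comp (wirtingerCLM ξ₁ ξ₂),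
            Complex.imCLM.comp (wirtingerCLM y₁ y₂)]) z := by
      rw [hasFDerivAt_pi]
      intro k
      fin_cases k
      · exact Complex.reCLM.hasFDerivAt.comp z hξ
      · exact Complex.imCLM.hasFDerivAt.comp z hξ
      · exact Complex.imCLM.hasFDerivAt.comp z hy
    exact h0.congr_of_eventuallyEq hf
  have hfz := hf.self_of_nhds
  simp only [phi, mcForm, leftTriv, hd.fderiv, hfz]
  refine ⟨?_, ?_, ?_⟩ <;> apply Complex.ext <;> simp <;> ring

/-! ### The Sym formula in terms of the frame entries -/

/-- The entry `U₀₁` of the connection form; the entry `V₁₀` is its conjugate. -/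
def offP (κ : ℂ → ℂ) (t : ℝ) (z : ℂ) : ℂ := -Complex.I * (Circle.exp t : ℂ)⁻¹ * κ z

/-- The entry `U₁₀` of the connection form; the entry `V₀₁` is its conjugate. -/
def offQ (κ B : ℂ → ℂ) (t : ℝ) (z : ℂ) : ℂ :=
  -Complex.I * (Circle.exp t : ℂ)⁻¹ * B z / κ z

/-- An extended frame written by its first row `(a, b)`, the second row being
`(conj b, conj a)`.  The spectral parameter is `e^{it}`, `κ = h / 4`, and `u = κ_z / (2 κ)` is
the diagonal entry of `U`.  The last field says that `B` is holomorphic. -/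
structure IsFrameRow (D : Set ℂ) (κ B u : ℂ → ℂ) (a b : ℝ → ℂ → ℂ) : Prop where
  isOpen : IsOpen D
  smooth_a : ContDiffOn ℝ ∞ (fun p : ℝ × ℂ => a p.1 p.2) (Set.univ ×ˢ D)
  smooth_b : ContDiffOn ℝ ∞ (fun p : ℝ × ℂ => b p.1 p.2) (Set.univ ×ˢ D)
  det : ∀ t, ∀ z ∈ D, a t z * conj (a t z) - b t z * conj (b t z) = 1
  wirtinger_a : ∀ t, ∀ z ∈ D, HasWirtinger (a t) (a t z * u z + b t z * offQ κ B t z)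
    (-(a t z * conj (u z)) + b t z * conj (offP κ t z)) z
  wirtinger_b : ∀ t, ∀ z ∈ D, HasWirtinger (b t) (a t z * offP κ t z - b t z * u z)
    (a t z * conj (offQ κ B t z) + b t z * conj (u z)) z
  kappa_pos : ∀ z ∈ D, ∃ r : ℝ, 0 < r ∧ κ z = r
  wirtinger_kappa : ∀ z ∈ D,
    HasWirtinger κ (2 * u z * κ z) (2 * conj (u z) * κ z) z
  wirtinger_B : ∀ z ∈ D, HasWirtinger B (dz B z) 0 z

theorem hasDerivAt_circleExp_inv (t : ℝ) :
    HasDerivAt (fun τ : ℝ => ((Circle.exp τ : ℂ))⁻¹)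
      (-Complex.I * (Circle.exp t : ℂ)⁻¹) t := by
  have h : ∀ τ : ℝ, ((Circle.exp τ : ℂ))⁻¹ = Complex.exp (-((τ : ℂ) * Complex.I)) := by
    intro τ
    rw [Circle.coe_exp, Complex.exp_neg]
  simp only [h]
  have h1 : HasDerivAt (fun τ : ℝ => -((τ : ℂ) * Complex.I)) (-Complex.I) t := by
    simpa using ((Complex.ofRealCLM.hasDerivAt (x := t)).mul_const Complex.I).fun_neg
  simpa [mul_comm] using h1.cexp

theorem hasDerivAt_offP (κ : ℂ → ℂ) (t : ℝ) (z : ℂ) :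
    HasDerivAt (fun τ => offP κ τ z) (-Complex.I * offP κ t z) t := by
  unfold offP
  refine (((hasDerivAt_circleExp_inv t).const_mul (-Complex.I)).mul_const (κ z)).congr_deriv ?_
  ring

theorem hasDerivAt_offQ (κ B : ℂ → ℂ) (t : ℝ) (z : ℂ) :
    HasDerivAt (fun τ => offQ κ B τ z) (-Complex.I * offQ κ B t z) t := by
  unfold offQ
  refine ((((hasDerivAt_circleExp_inv t).const_mul (-Complex.I)).mul_const
    (B z)).div_const (κ z)).congr_deriv ?_
  ring

theorem hasDerivAt_conj {g : ℝ → ℂ} {g' : ℂ} {t : ℝ} (h : HasDerivAt g g' t) :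
    HasDerivAt (fun τ => conj (g τ)) (conj g') t :=
  (Complex.conjCLE : ℂ →L[ℝ] ℂ).hasFDerivAt.comp_hasDerivAt t h

/-- The entry `m₀₁` of `m_±`, for `ε = ± 1`. -/
def potOff (ε : ℂ) (a b : ℝ → ℂ → ℂ) (t : ℝ) (z : ℂ) : ℂ :=
  deriv (fun τ => a τ z) t * b t z - deriv (fun τ => b τ z) t * a t z
    - ε * Complex.I * (a t z * b t z)

/-- The entry `m₀₀` of `m_±`, for `ε = ± 1`. -/
def potDiag (ε : ℂ) (a b : ℝ → ℂ → ℂ) (t : ℝ) (z : ℂ) : ℂ :=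
  ε * (Complex.I / 2) * (a t z * conj (a t z) + b t z * conj (b t z))
    - (deriv (fun τ => a τ z) t * conj (a t z) - deriv (fun τ => b τ z) t * conj (b t z))

/-- The surface `f_±` of the Sym formula, for `ε = ± 1`.  Here `x₁ + i x₂ = -2i m₀₁`, and `x₃ = Im ∂_t m₀₀` because
`λ ∂_λ = -i ∂_t`. -/
def symSurface (ε : ℂ) (a b : ℝ → ℂ → ℂ) (t : ℝ) (z : ℂ) : Nil3 :=
  ![(-2 * Complex.I * potOff ε a b t z).re, (-2 * Complex.I * potOff ε a b t z).im,
    (deriv (fun τ => potDiag ε a b τ z) t).im]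

namespace IsFrameRow

variable {D : Set ℂ} {κ B u : ℂ → ℂ} {a b : ℝ → ℂ → ℂ} {z : ℂ}

theorem hasDerivAt_a (h : IsFrameRow D κ B u a b) (hz : z ∈ D) (t : ℝ) :
    HasDerivAt (fun τ => a τ z) (deriv (fun τ => a τ z) t) t :=
  (deriv_param_eq h.isOpen h.smooth_a hz t).differentiableAt.hasDerivAt

theorem hasDerivAt_b (h : IsFrameRow D κ B u a b) (hz : z ∈ D) (t : ℝ) :
    HasDerivAt (fun τ => b τ z) (deriv (fun τ => b τ z) t) t :=
  (deriv_param_eq h.isOpen h.smooth_b hz t).differentiableAt.hasDerivAt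

theorem hasWirtinger_deriv_a (h : IsFrameRow D κ B u a b) (hz : z ∈ D) (t : ℝ) :
    HasWirtinger (fun w => deriv (fun τ => a τ w) t)
      (deriv (fun τ => a τ z) t * u z + (deriv (fun τ => b τ z) t * offQ κ B t z
        + b t z * (-Complex.I * offQ κ B t z)))
      (-(deriv (fun τ => a τ z) t * conj (u z)) + (deriv (fun τ => b τ z) t * conj (offP κ t z)
        + b t z * conj (-Complex.I * offP κ t z))) z :=
  HasWirtinger.deriv_param h.isOpen h.smooth_a hz (fun τ => h.wirtinger_a τ z hz)
    (((h.hasDerivAt_a hz t).mul_const _).add ((h.hasDerivAt_b hz t).mul (hasDerivAt_offQ κ B t z)))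
    (((h.hasDerivAt_a hz t).mul_const _).fun_neg.add
      ((h.hasDerivAt_b hz t).mul (hasDerivAt_conj (hasDerivAt_offP κ t z))))

theorem hasWirtinger_deriv_b (h : IsFrameRow D κ B u a b) (hz : z ∈ D) (t : ℝ) :
    HasWirtinger (fun w => deriv (fun τ => b τ w) t)
      ((deriv (fun τ => a τ z) t * offP κ t z + a t z * (-Complex.I * offP κ t z))
        - deriv (fun τ => b τ z) t * u z)
      ((deriv (fun τ => a τ z) t * conj (offQ κ B t z)
        + a t z * conj (-Complex.I * offQ κ B t z)) + deriv (fun τ => b τ z) t * conj (u z)) z :=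
  HasWirtinger.deriv_param h.isOpen h.smooth_b hz (fun τ => h.wirtinger_b τ z hz)
    (((h.hasDerivAt_a hz t).mul (hasDerivAt_offP κ t z)).sub ((h.hasDerivAt_b hz t).mul_const _))
    (((h.hasDerivAt_a hz t).mul (hasDerivAt_conj (hasDerivAt_offQ κ B t z))).add
      ((h.hasDerivAt_b hz t).mul_const _))

theorem hasWirtinger_potOff (h : IsFrameRow D κ B u a b) (hz : z ∈ D) (ε : ℂ) (t : ℝ) :
    HasWirtinger (potOff ε a b t)
      (Complex.I * ((1 - ε) * offP κ t z * a t z ^ 2 - (1 + ε) * offQ κ B t z * b t z ^ 2))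
      (Complex.I * ((1 - ε) * conj (offP κ t z) * b t z ^ 2
        - (1 + ε) * conj (offQ κ B t z) * a t z ^ 2)) z := by
  have ha := h.wirtinger_a t z hz
  have hb := h.wirtinger_b t z hz
  refine ((((h.hasWirtinger_deriv_a hz t).mul hb).sub
    ((h.hasWirtinger_deriv_b hz t).mul ha)).sub
      ((ha.mul hb).const_mul (ε * Complex.I))).congr_deriv ?_ ?_
  · ring
  · simp only [map_mul, map_neg, Complex.conj_I]
    ring

theorem hasWirtinger_potDiag (h : IsFrameRow D κ B u a b) (hz : z ∈ D) (ε : ℂ) (t : ℝ) :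
    HasWirtinger (potDiag ε a b t)
      (Complex.I * ((1 + ε) * offQ κ B t z * (b t z * conj (a t z))
        - (1 - ε) * offP κ t z * (a t z * conj (b t z))))
      (Complex.I * ((1 + ε) * conj (offQ κ B t z) * (a t z * conj (b t z))
        - (1 - ε) * conj (offP κ t z) * (b t z * conj (a t z)))) z := by
  have ha := h.wirtinger_a t z hz
  have hb := h.wirtinger_b t z hz
  refine ((((ha.mul ha.conj_comp).add (hb.mul hb.conj_comp)).const_mul (ε * (Complex.I / 2))).sub
    (((h.hasWirtinger_deriv_a hz t).mul ha.conj_comp).sub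
      ((h.hasWirtinger_deriv_b hz t).mul hb.conj_comp))).congr_deriv ?_ ?_
  · simp only [map_mul, map_neg, map_add, Complex.conj_conj]
    ring
  · simp only [map_mul, map_neg, map_add, map_sub, Complex.conj_I]
    ring

theorem hasWirtinger_deriv_potDiag (h : IsFrameRow D κ B u a b) (hz : z ∈ D) (ε : ℂ) (t : ℝ)
    (hs : ContDiffOn ℝ ∞ (fun p : ℝ × ℂ => potDiag ε a b p.1 p.2) (Set.univ ×ˢ D)) :
    ∃ y₁ y₂, HasWirtinger (fun w => deriv (fun τ => potDiag ε a b τ w) t) y₁ y₂ z ∧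
      y₁ = Complex.I * ((1 + ε) * offQ κ B t z * (-Complex.I * (b t z * conj (a t z))
          + deriv (fun τ => b τ z) t * conj (a t z) + b t z * conj (deriv (fun τ => a τ z) t))
        - (1 - ε) * offP κ t z * (-Complex.I * (a t z * conj (b t z))
          + deriv (fun τ => a τ z) t * conj (b t z) + a t z * conj (deriv (fun τ => b τ z) t))) ∧
      y₂ = Complex.I * ((1 + ε) * conj (offQ κ B t z) * (Complex.I * (a t z * conj (b t z))
          + deriv (fun τ => a τ z) t * conj (b t z) + a t z * conj (deriv (fun τ => b τ z) t))
        - (1 - ε) * conj (offP κ t z) * (Complex.I * (b t z * conj (a t z))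
          + deriv (fun τ => b τ z) t * conj (a t z)
          + b t z * conj (deriv (fun τ => a τ z) t))) := by
  have ha := h.hasDerivAt_a hz t
  have hb := h.hasDerivAt_b hz t
  have hp := hasDerivAt_offP κ t z
  have hq := hasDerivAt_offQ κ B t z
  have hac := hasDerivAt_conj ha
  have hbc := hasDerivAt_conj hb
  refine ⟨_, _, HasWirtinger.deriv_param h.isOpen hs hz
    (fun τ => h.hasWirtinger_potDiag hz ε τ)
    ((((hq.const_mul (1 + ε)).mul (hb.mul hac)).sub
      ((hp.const_mul (1 - ε)).mul (ha.mul hbc))).const_mul Complex.I)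
    (((((hasDerivAt_conj hq).const_mul (1 + ε)).mul (ha.mul hbc)).sub
      (((hasDerivAt_conj hp).const_mul (1 - ε)).mul (hb.mul hac))).const_mul Complex.I), ?_, ?_⟩
  · simp only [Pi.mul_apply]
    ring
  · simp only [map_mul, map_neg, Complex.conj_I, Pi.mul_apply]
    ring

theorem contDiffOn_potOff (h : IsFrameRow D κ B u a b) (ε : ℂ) :
    ContDiffOn ℝ ∞ (fun p : ℝ × ℂ => potOff ε a b p.1 p.2) (Set.univ ×ˢ D) := by
  have ha := h.smooth_a
  have hb := h.smooth_b
  have ha' := contDiffOn_deriv_param h.isOpen ha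
  have hb' := contDiffOn_deriv_param h.isOpen hb
  unfold potOff
  exact ((ha'.mul hb).sub (hb'.mul ha)).sub (contDiffOn_const.mul (ha.mul hb))

theorem contDiffOn_potDiag (h : IsFrameRow D κ B u a b) (ε : ℂ) :
    ContDiffOn ℝ ∞ (fun p : ℝ × ℂ => potDiag ε a b p.1 p.2) (Set.univ ×ˢ D) := by
  have ha := h.smooth_a
  have hb := h.smooth_b
  have ha' := contDiffOn_deriv_param h.isOpen ha
  have hb' := contDiffOn_deriv_param h.isOpen hb
  unfold potDiag
  exact (contDiffOn_const.mul ((ha.mul (contDiffOn_conj ha)).add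
    (hb.mul (contDiffOn_conj hb)))).sub
      ((ha'.mul (contDiffOn_conj ha)).sub (hb'.mul (contDiffOn_conj hb)))

theorem contDiffOn_symSurface (h : IsFrameRow D κ B u a b) (ε : ℂ) (t : ℝ) :
    ContDiffOn ℝ ∞ (symSurface ε a b t) D := by
  have hi : ContDiffOn ℝ ∞ (fun w : ℂ => ((t, w) : ℝ × ℂ)) D :=
    contDiffOn_const.prodMk contDiffOn_id
  have hm : Set.MapsTo (fun w : ℂ => ((t, w) : ℝ × ℂ)) D (Set.univ ×ˢ D) :=
    fun w hw => ⟨trivial, hw⟩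
  have h0 : ContDiffOn ℝ ∞ (fun w => potOff ε a b t w) D :=
    ContDiffOn.comp (h.contDiffOn_potOff ε) hi hm
  have h1 : ContDiffOn ℝ ∞ (fun w => -2 * Complex.I * potOff ε a b t w) D :=
    contDiffOn_const.mul h0
  have hy : ContDiffOn ℝ ∞ (fun p : ℝ × ℂ => deriv (fun τ => potDiag ε a b τ p.2) p.1)
      (Set.univ ×ˢ D) :=
    contDiffOn_deriv_param (g := potDiag ε a b) h.isOpen (h.contDiffOn_potDiag ε)
  have h2 : ContDiffOn ℝ ∞ (fun w => deriv (fun τ => potDiag ε a b τ w) t) D := by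
    have := hy.comp hi hm
    exact this
  have e0 : ContDiffOn ℝ ∞ (fun w => (-2 * Complex.I * potOff ε a b t w).re) D :=
    Complex.reCLM.contDiff.comp_contDiffOn h1
  have e1 : ContDiffOn ℝ ∞ (fun w => (-2 * Complex.I * potOff ε a b t w).im) D :=
    Complex.imCLM.contDiff.comp_contDiffOn h1
  have e2 : ContDiffOn ℝ ∞ (fun w => (deriv (fun τ => potDiag ε a b τ w) t).im) D :=
    Complex.imCLM.contDiff.comp_contDiffOn h2
  refine contDiffOn_pi.2 (Fin.forall_fin_succ.2 ⟨e0, Fin.forall_fin_succ.2 ⟨e1, ?_⟩⟩)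
  refine Fin.forall_fin_succ.2 ⟨e2, fun i => i.elim0⟩

/-- The relation `∂_t (|a|² - |b|²) = 0`. -/
theorem deriv_det (h : IsFrameRow D κ B u a b) (hz : z ∈ D) (t : ℝ) :
    deriv (fun τ => a τ z) t * conj (a t z) + a t z * conj (deriv (fun τ => a τ z) t)
      - (deriv (fun τ => b τ z) t * conj (b t z)
        + b t z * conj (deriv (fun τ => b τ z) t)) = 0 := by
  have ha := h.hasDerivAt_a hz t
  have hb := h.hasDerivAt_b hz t
  have h1 := (ha.mul (hasDerivAt_conj ha)).sub (hb.mul (hasDerivAt_conj hb))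
  have h2 : HasDerivAt (fun τ => a τ z * conj (a τ z) - b τ z * conj (b τ z)) 0 t := by
    have : (fun τ => a τ z * conj (a τ z) - b τ z * conj (b τ z)) = fun _ => 1 :=
      funext fun τ => h.det τ z hz
    rw [this]
    exact hasDerivAt_const t 1
  exact h1.unique h2

/-- The null data of `f_-`. The off-diagonal entry `m₀₁` gives `φ₁` and `φ₂` at once; in `φ₃`, the
derivatives `∂_t a`, `∂_t b` coming from the twist term of the metric cancel those of `∂_t m₀₀`,
by `|a|² - |b|² = 1` and its `t`-derivative. -/
theorem hasNullData_minus (h : IsFrameRow D κ B u a b) {f : ℂ → Nil3} {t : ℝ}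
    (hf : ∀ w ∈ D, f w = symSurface (-1) a b t w) (hz : z ∈ D) :
    HasNullData f z (2 * Complex.I * offP κ t z) (a t z)
      (conj (b t z)) := by
  obtain ⟨y₁, y₂, hy, e₁, e₂⟩ :=
    h.hasWirtinger_deriv_potDiag hz (-1) t (h.contDiffOn_potDiag (-1))
  obtain ⟨h0, h1, h2⟩ := phi_of_hasWirtinger (f := f)
    (Filter.eventually_of_mem (h.isOpen.mem_nhds hz) hf)
    ((h.hasWirtinger_potOff hz (-1) t).const_mul (-2 * Complex.I)) hy
  have i2 : Complex.I ^ 2 = -1 := Complex.I_sq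
  have i3 : Complex.I ^ 3 = -Complex.I := Complex.I_pow_three
  have i4 : Complex.I ^ 4 = 1 := Complex.I_pow_four
  have i5 : Complex.I ^ 5 = Complex.I := by linear_combination Complex.I * i4
  have d1 := h.det t z hz
  have d2 := h.deriv_det hz t
  refine ⟨?_, ?_, ?_⟩
  · rw [h0]
    simp only [map_mul, map_sub, map_add, map_neg, map_pow, map_ofNat, map_one, Complex.conj_conj,
      Complex.conj_I]
    ring_nf
  · rw [h1]
    simp only [map_mul, map_sub, map_add, map_neg, map_pow, map_ofNat, map_one, Complex.conj_conj,
      Complex.conj_I]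
    ring_nf
    simp only [i3]
    ring
  · rw [h2, e₁, e₂]
    simp only [potOff, map_mul, map_sub, map_add, map_neg, map_pow, map_ofNat, map_one,
      Complex.conj_conj, Complex.conj_I]
    linear_combination (norm := skip) -2 * offP κ t z * conj (b t z) * a t z * d2
      + 2 * offP κ t z * (a t z * conj (deriv (fun τ => b τ z) t)
        + conj (b t z) * deriv (fun τ => a τ z) t + Complex.I * a t z * conj (b t z)) * d1
    ring_nf
    simp only [i2, i3, i4, i5]
    ring

/-- The null data of `f_+`, obtained as for `f_-`. -/
theorem hasNullData_plus (h : IsFrameRow D κ B u a b) {f : ℂ → Nil3} {t : ℝ}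
    (hf : ∀ w ∈ D, f w = symSurface 1 a b t w) (hz : z ∈ D) :
    HasNullData f z (-2 * Complex.I * offQ κ B t z) (b t z)
      (conj (a t z)) := by
  obtain ⟨y₁, y₂, hy, e₁, e₂⟩ :=
    h.hasWirtinger_deriv_potDiag hz 1 t (h.contDiffOn_potDiag 1)
  obtain ⟨h0, h1, h2⟩ := phi_of_hasWirtinger (f := f)
    (Filter.eventually_of_mem (h.isOpen.mem_nhds hz) hf)
    ((h.hasWirtinger_potOff hz 1 t).const_mul (-2 * Complex.I)) hy
  have i2 : Complex.I ^ 2 = -1 := Complex.I_sq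
  have i3 : Complex.I ^ 3 = -Complex.I := Complex.I_pow_three
  have i4 : Complex.I ^ 4 = 1 := Complex.I_pow_four
  have i5 : Complex.I ^ 5 = Complex.I := by linear_combination Complex.I * i4
  have d1 := h.det t z hz
  have d2 := h.deriv_det hz t
  refine ⟨?_, ?_, ?_⟩
  · rw [h0]
    simp only [map_mul, map_sub, map_add, map_neg, map_pow, map_ofNat, map_one, Complex.conj_conj,
      Complex.conj_I]
    ring_nf
  · rw [h1]
    simp only [map_mul, map_sub, map_add, map_neg, map_pow, map_ofNat, map_one, Complex.conj_conj,
      Complex.conj_I]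
    ring_nf
    simp only [i3]
    ring
  · rw [h2, e₁, e₂]
    simp only [potOff, map_mul, map_sub, map_add, map_neg, map_pow, map_ofNat, map_one,
      Complex.conj_conj, Complex.conj_I]
    linear_combination (norm := skip) 2 * offQ κ B t z * conj (a t z) * b t z * d2
      - 2 * offQ κ B t z * (deriv (fun τ => b τ z) t * conj (a t z)
        + conj (deriv (fun τ => a τ z) t) * b t z + Complex.I * conj (a t z) * b t z) * d1
    ring_nf
    simp only [i2, i3, i4, i5]
    ring

end IsFrameRow

/-! ### The normal Gauss map -/

/-- A half-turn about the `x₃`-axis replaces the null data `(c, A, C)` by `(-c, A, -C)`. -/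
theorem HasNullData.halfTurn {f : ℂ → Nil3} {z c A C : ℂ} (h : HasNullData f z c A C)
    (hf : DifferentiableAt ℝ f z) :
    HasNullData (fun w => halfTurn (f w)) z (-c) A (-C) := by
  have hd : HasFDerivAt (fun w => NilSurf.halfTurn (f w)) (ContinuousLinearMap.pi
      ![-(ContinuousLinearMap.proj 0).comp (fderiv ℝ f z),
        -(ContinuousLinearMap.proj 1).comp (fderiv ℝ f z),
        (ContinuousLinearMap.proj 2).comp (fderiv ℝ f z)]) z := by
    have hk := hasFDerivAt_pi'.1 hf.hasFDerivAt
    refine hasFDerivAt_pi.2 (Fin.forall_fin_succ.2 ⟨(hk 0).fun_neg,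
      Fin.forall_fin_succ.2 ⟨(hk 1).fun_neg, Fin.forall_fin_succ.2 ⟨hk 2, fun i => i.elim0⟩⟩⟩)
  have e : ∀ k, phi (fun w => NilSurf.halfTurn (f w)) z k
      = (![-phi f z 0, -phi f z 1, phi f z 2] : Fin 3 → ℂ) k := by
    intro k
    fin_cases k <;>
      simp only [phi, mcForm, leftTriv, hd.fderiv] <;> simp [NilSurf.halfTurn] <;> ring
  obtain ⟨h0, h1, h2⟩ := h
  refine ⟨?_, ?_, ?_⟩
  · rw [e]; simp [h0]
  · rw [e]; simp [h1]
  · rw [e]; simp [h2]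

theorem HasNullData.unitNormal_two {f : ℂ → Nil3} {z c A C : ℂ} (h : HasNullData f z c A C)
    (hc : c ≠ 0) : unitNormal f z 2
      = (Complex.normSq A + Complex.normSq C)⁻¹ * (Complex.normSq A - Complex.normSq C) := by
  rw [h.unitNormal_eq hc]
  simp

/-- The normal Gauss map of a surface with upward (`δ = 1`) or downward (`δ = -1`) normal. -/
theorem HasNullData.gaussMap_eq {f : ℂ → Nil3} {z c A C : ℂ} (h : HasNullData f z c A C)
    (hc : c ≠ 0) {δ : ℝ} (hδ : Complex.normSq A - Complex.normSq C = δ) (hδ2 : δ ^ 2 = 1) :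
    gaussMap f z = 2 * Complex.I * δ * (A * conj C) / (A * conj A + C * conj C + 1) := by
  have hA := Complex.normSq_nonneg A
  have hC := Complex.normSq_nonneg C
  set σ := Complex.normSq A + Complex.normSq C with hσ
  have hσ0 : 0 < σ := by
    rcases (add_nonneg hA hC).lt_or_eq with h1 | h1
    · exact h1
    · have : δ = 0 := by rw [← hδ]; linarith
      simp [this] at hδ2
  have hup : upwardNormal f z = (δ * σ⁻¹) • ![-2 * (A * conj C).im, 2 * (A * conj C).re, δ] := by
    unfold upwardNormal
    rw [h.unitNormal_two hc, h.unitNormal_eq hc, hδ, ← hσ]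
    rcases eq_or_eq_neg_of_sq_eq_sq δ 1 (by rw [hδ2, one_pow]) with h1 | h1
    · rw [h1, if_neg (by simpa using hσ0.le), one_mul]
    · rw [h1, if_pos (by simpa using hσ0), ← neg_smul, neg_one_mul]
  have hσc : (σ : ℂ) = A * conj A + C * conj C := by
    rw [hσ]; push_cast; rw [Complex.mul_conj, Complex.mul_conj]
  have hσ1 : (σ : ℂ) ≠ 0 := by exact_mod_cast hσ0.ne'
  have hσ2 : (σ : ℂ) + 1 ≠ 0 := by
    have : σ + 1 ≠ 0 := by positivity
    exact_mod_cast this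
  have hδc : (δ : ℂ) ^ 2 = 1 := by exact_mod_cast hδ2
  have e : (A * conj C) = ((A * conj C).re : ℂ) + (A * conj C).im * Complex.I :=
    (Complex.re_add_im _).symm
  have hden : 1 + ((δ * σ⁻¹ * δ : ℝ) : ℂ) = (σ + 1) / σ := by
    push_cast
    field_simp
    linear_combination hδc
  unfold gaussMap
  rw [hup, ← hσc]
  simp only [Pi.smul_apply, smul_eq_mul, Matrix.cons_val]
  rw [hden]
  nth_rw 3 [e]
  push_cast
  field_simp
  linear_combination -(δ : ℂ) * ((A * conj C).im : ℂ) * Complex.I_sq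

/-- `(i/2) Ad(F) σ₃` for `F` with first row `(a, b)`, as a point of the hyperbolic plane. -/
theorem hyperbolicPoint_frame {a b : ℂ} (h : a * conj a - b * conj b = 1) :
    hyperbolicPoint (2 * Complex.I * (a * b) / (a * conj a + b * conj b + 1))
      = (Complex.I / 2) • !![a * conj a + b * conj b, -2 * (a * b);
          2 * (conj a * conj b), -(a * conj a + b * conj b)] := by
  have ha : conj a ≠ 0 := by
    intro h0
    have ha : a = 0 := by simpa using h0
    have h1 := congrArg Complex.re h
    rw [ha, zero_mul, Complex.mul_conj] at h1
    simp at h1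
    linarith [Complex.normSq_nonneg b]
  have ha' : a ≠ 0 := by simpa using ha
  have e1 : 2 * Complex.I * (a * b) / (a * conj a + b * conj b + 1) = Complex.I * b / conj a := by
    have : a * conj a + b * conj b + 1 = 2 * (a * conj a) := by linear_combination -h
    rw [this]
    field_simp
  have e2 : ((‖Complex.I * b / conj a‖ : ℝ) : ℂ) ^ 2 = b * conj b / (a * conj a) := by
    rw [← Complex.ofReal_pow, ← Complex.normSq_eq_norm_sq, ← Complex.mul_conj]
    simp
    field_simp
    linear_combination - b * conj b * Complex.I_sq
  have e3 : 1 - b * conj b / (a * conj a) = 1 / (a * conj a) := by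
    field_simp
    linear_combination h
  rw [e1, hyperbolicPoint, e2, e3]
  ext i j
  fin_cases i <;> fin_cases j <;> simp <;> field_simp
  · linear_combination b * Complex.I_sq
  · linear_combination -conj b * Complex.I_sq

/-! ### The two surfaces of the Sym formula -/

namespace IsFrameRow

variable {D : Set ℂ} {κ B u : ℂ → ℂ} {a b : ℝ → ℂ → ℂ} {z : ℂ} {f : ℂ → Nil3} {t : ℝ}

theorem kappa_ne (h : IsFrameRow D κ B u a b) (hz : z ∈ D) : κ z ≠ 0 := by
  obtain ⟨r, hr, e⟩ := h.kappa_pos z hz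
  rw [e]
  exact_mod_cast hr.ne'

theorem normSq_sub (h : IsFrameRow D κ B u a b) (hz : z ∈ D) (t : ℝ) :
    Complex.normSq (a t z) - Complex.normSq (b t z) = 1 := by
  have := h.det t z hz
  rw [Complex.mul_conj, Complex.mul_conj] at this
  exact_mod_cast this

theorem two_I_offP_ne (h : IsFrameRow D κ B u a b) (hz : z ∈ D) (t : ℝ) :
    2 * Complex.I * offP κ t z ≠ 0 := by
  simp [offP, h.kappa_ne hz]

theorem two_I_offQ_ne (h : IsFrameRow D κ B u a b) (hz : z ∈ D) (hB : B z ≠ 0) (t : ℝ) :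
    -2 * Complex.I * offQ κ B t z ≠ 0 := by
  simp [offQ, h.kappa_ne hz, hB]

theorem minimal_minus (h : IsFrameRow D κ B u a b)
    (hf : ∀ w ∈ D, f w = symSurface (-1) a b t w) (hz : z ∈ D) :
    meanCurvature f z = 0 ∧ abreschRosenberg f z = (Circle.exp t : ℂ)⁻¹ ^ 2 * B z := by
  have hκ := h.kappa_ne hz
  have hn := h.normSq_sub hz t
  refine minimal_of_dirac (c := fun w => 2 * Complex.I * offP κ t w) (A := a t)
    (C := fun w => conj (b t w)) (u := u z) (v := -conj (u z)) (q := offQ κ B t z)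
    (s := conj (offP κ t z)) (c' := 2 * u z * (2 * Complex.I * offP κ t z)) (δ := 1)
    (Filter.eventually_of_mem (h.isOpen.mem_nhds hz) fun w hw => h.hasNullData_minus hf hw)
    (h.two_I_offP_ne hz t) (by simpa [Complex.normSq_conj] using hn) (by norm_num) ?_ ?_ ?_ ?_ ?_
  · unfold offP
    refine (((h.wirtinger_kappa z hz).const_mul _).const_mul _).congr_deriv ?_ ?_ <;> ring
  · refine (h.wirtinger_a t z hz).congr_deriv ?_ ?_ <;> rw [Complex.conj_conj] <;> ring
  · refine (h.wirtinger_b t z hz).conj_comp.congr_deriv ?_ ?_ <;>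
      simp only [map_add, map_sub, map_mul, Complex.conj_conj] <;> ring
  · simp only [map_mul, Complex.conj_I, map_ofNat, Complex.ofReal_one]
    linear_combination 2 * Complex.I * (offP κ t z * conj (offP κ t z)) * Complex.I_sq
  · simp only [offP, offQ, Complex.ofReal_one]
    field_simp
    linear_combination B z * Complex.I_sq

/-- The Dirac-type equations for `f_+`; the equation for `c_z̄` is where the holomorphy of `B` is
used. -/
theorem minimal_plus (h : IsFrameRow D κ B u a b)
    (hf : ∀ w ∈ D, f w = symSurface 1 a b t w) (hz : z ∈ D) (hB : B z ≠ 0) :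
    meanCurvature f z = 0 ∧ abreschRosenberg f z = (Circle.exp t : ℂ)⁻¹ ^ 2 * B z := by
  have hκ := h.kappa_ne hz
  have hn := h.normSq_sub hz t
  refine minimal_of_dirac (c := fun w => -2 * Complex.I * offQ κ B t w) (A := b t)
    (C := fun w => conj (a t w)) (u := -u z) (v := conj (u z)) (q := offP κ t z)
    (s := conj (offQ κ B t z)) (δ := -1)
    (c' := -2 * Complex.I * (-Complex.I * (Circle.exp t : ℂ)⁻¹)
      * (dz B z * (κ z)⁻¹ + B z * (-(2 * u z * κ z) / κ z ^ 2)))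
    (Filter.eventually_of_mem (h.isOpen.mem_nhds hz) fun w hw => h.hasNullData_plus hf hw)
    (h.two_I_offQ_ne hz hB t) (by rw [Complex.normSq_conj]; linarith) (by norm_num)
    ?_ ?_ ?_ ?_ ?_
  · have e : (fun w => -2 * Complex.I * offQ κ B t w) = fun w =>
        -2 * Complex.I * (-Complex.I * (Circle.exp t : ℂ)⁻¹) * (B w * (κ w)⁻¹) := by
      funext w
      simp only [offQ]
      ring
    rw [e]
    refine (((h.wirtinger_B z hz).mul ((h.wirtinger_kappa z hz).inv hκ)).const_mul
      _).congr_deriv rfl ?_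
    simp only [offQ]
    field_simp
    ring
  · refine (h.wirtinger_b t z hz).congr_deriv ?_ ?_ <;> rw [Complex.conj_conj] <;> ring
  · refine (h.wirtinger_a t z hz).conj_comp.congr_deriv ?_ ?_ <;>
      simp only [map_add, map_neg, map_mul, Complex.conj_conj] <;> ring
  · simp only [map_mul, map_neg, Complex.conj_I, map_ofNat, Complex.ofReal_neg,
      Complex.ofReal_one]
    linear_combination
      -2 * Complex.I * (offQ κ B t z * conj (offQ κ B t z)) * Complex.I_sq
  · simp only [offP, offQ, Complex.ofReal_neg, Complex.ofReal_one]
    field_simp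
    linear_combination -Complex.I_sq

theorem contDiffOn_of_eq (h : IsFrameRow D κ B u a b) {ε : ℂ}
    (hf : ∀ w ∈ D, f w = symSurface ε a b t w) : ContDiffOn ℝ ∞ f D :=
  (h.contDiffOn_symSurface ε t).congr hf

theorem unitNormal_minus_pos (h : IsFrameRow D κ B u a b)
    (hf : ∀ w ∈ D, f w = symSurface (-1) a b t w) (hz : z ∈ D) : 0 < unitNormal f z 2 := by
  have hn := h.normSq_sub hz t
  have hb := Complex.normSq_nonneg (b t z)
  rw [(h.hasNullData_minus hf hz).unitNormal_two (h.two_I_offP_ne hz t), Complex.normSq_conj, hn,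
    mul_one]
  exact inv_pos.2 (by linarith)

theorem unitNormal_plus_neg (h : IsFrameRow D κ B u a b)
    (hf : ∀ w ∈ D, f w = symSurface 1 a b t w) (hz : z ∈ D) (hB : B z ≠ 0) :
    unitNormal f z 2 < 0 := by
  have hn := h.normSq_sub hz t
  have hb := Complex.normSq_nonneg (b t z)
  rw [(h.hasNullData_plus hf hz).unitNormal_two (h.two_I_offQ_ne hz hB t), Complex.normSq_conj]
  have : 0 < (Complex.normSq (b t z) + Complex.normSq (a t z))⁻¹ := inv_pos.2 (by linarith)
  nlinarith

theorem isMinimalSurface_minus (h : IsFrameRow D κ B u a b)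
    (hf : ∀ w ∈ D, f w = symSurface (-1) a b t w) : IsMinimalSurface f D where
  smooth := h.contDiffOn_of_eq hf
  conformal z hz := (h.hasNullData_minus hf hz).conformal
  immersed z hz := by
    have hn := h.normSq_sub hz t
    have hb := Complex.normSq_nonneg (b t z)
    have hc := norm_pos_iff.2 (h.two_I_offP_ne hz t)
    rw [(h.hasNullData_minus hf hz).confFactor_eq, Complex.normSq_conj]
    have : 0 < Complex.normSq (a t z) + Complex.normSq (b t z) := by linarith
    positivity
  minimal z hz := (h.minimal_minus hf hz).1
  nonvertical z hz := (h.unitNormal_minus_pos hf hz).ne'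

theorem isMinimalSurface_plus (h : IsFrameRow D κ B u a b)
    (hf : ∀ w ∈ D, f w = symSurface 1 a b t w) : IsMinimalSurface f {z ∈ D | B z ≠ 0} where
  smooth := (h.contDiffOn_of_eq hf).mono fun _ hz => hz.1
  conformal z hz := (h.hasNullData_plus hf hz.1).conformal
  immersed z hz := by
    have hn := h.normSq_sub hz.1 t
    have hb := Complex.normSq_nonneg (b t z)
    have hc := norm_pos_iff.2 (h.two_I_offQ_ne hz.1 hz.2 t)
    rw [(h.hasNullData_plus hf hz.1).confFactor_eq, Complex.normSq_conj]
    have : 0 < Complex.normSq (b t z) + Complex.normSq (a t z) := by linarith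
    positivity
  minimal z hz := (h.minimal_plus hf hz.1 hz.2).1
  nonvertical z hz := (h.unitNormal_plus_neg hf hz.1 hz.2).ne

theorem gaussMap_minus (h : IsFrameRow D κ B u a b)
    (hf : ∀ w ∈ D, f w = symSurface (-1) a b t w) (hz : z ∈ D) :
    gaussMap f z = 2 * Complex.I * (a t z * b t z)
      / (a t z * conj (a t z) + b t z * conj (b t z) + 1) := by
  rw [(h.hasNullData_minus hf hz).gaussMap_eq (h.two_I_offP_ne hz t) (δ := 1)
    (by rw [Complex.normSq_conj]; exact h.normSq_sub hz t) (by norm_num)]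
  simp [mul_comm]

theorem gaussMap_halfTurn_plus (h : IsFrameRow D κ B u a b)
    (hf : ∀ w ∈ D, f w = symSurface 1 a b t w) (hz : z ∈ D) (hB : B z ≠ 0) :
    gaussMap (fun w => halfTurn (f w)) z = 2 * Complex.I * (a t z * b t z)
      / (a t z * conj (a t z) + b t z * conj (b t z) + 1) := by
  have hd : DifferentiableAt ℝ f z :=
    ((h.contDiffOn_of_eq hf).contDiffAt (h.isOpen.mem_nhds hz)).differentiableAt (by simp)
  rw [((h.hasNullData_plus hf hz).halfTurn hd).gaussMap_eq
    (neg_ne_zero.2 (h.two_I_offQ_ne hz hB t)) (δ := -1)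
    (by rw [Complex.normSq_neg, Complex.normSq_conj]; linarith [h.normSq_sub hz t])
    (by norm_num)]
  simp only [map_neg, Complex.conj_conj, Complex.ofReal_neg, Complex.ofReal_one]
  congr 1 <;> ring

theorem offQ_eq (h : IsFrameRow D κ B u a b) (hz : z ∈ D) (t : ℝ) :
    -4 * ((Circle.exp t : ℂ)⁻¹ ^ 2 * B z) / (2 * Complex.I * offP κ t z)
      = -2 * Complex.I * offQ κ B t z := by
  have hκ := h.kappa_ne hz
  unfold offP offQ
  field_simp
  linear_combination 4 * B z * (1 - Complex.I ^ 2) * Complex.I_sq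

theorem offP_eq (h : IsFrameRow D κ B u a b) (hz : z ∈ D) (hB : B z ≠ 0) (t : ℝ) :
    -4 * ((Circle.exp t : ℂ)⁻¹ ^ 2 * B z) / (-2 * Complex.I * offQ κ B t z)
      = 2 * Complex.I * offP κ t z := by
  rw [← h.offQ_eq hz t]
  have := h.two_I_offP_ne hz t
  field_simp

theorem isDual_minus_plus (h : IsFrameRow D κ B u a b) {f₁ f₂ : ℂ → Nil3}
    (h₁ : ∀ w ∈ D, f₁ w = symSurface (-1) a b t w) (h₂ : ∀ w ∈ D, f₂ w = symSurface 1 a b t w) :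
    IsDual f₁ f₂ {z ∈ D | B z ≠ 0} := by
  intro z hz
  refine (h.hasNullData_minus h₁ hz.1).dual (h.two_I_offP_ne hz.1 t) ?_
    (h.minimal_minus h₁ hz.1).2 ?_
  · rw [Complex.normSq_conj, h.normSq_sub hz.1, one_pow]
  · rw [h.offQ_eq hz.1, Complex.conj_conj]
    exact h.hasNullData_plus h₂ hz.1

theorem isDual_plus_minus (h : IsFrameRow D κ B u a b) {f₁ f₂ : ℂ → Nil3}
    (h₁ : ∀ w ∈ D, f₁ w = symSurface (-1) a b t w) (h₂ : ∀ w ∈ D, f₂ w = symSurface 1 a b t w) :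
    IsDual f₂ f₁ {z ∈ D | B z ≠ 0} := by
  intro z hz
  refine (h.hasNullData_plus h₂ hz.1).dual (h.two_I_offQ_ne hz.1 hz.2 t) ?_
    (h.minimal_plus h₂ hz.1 hz.2).2 ?_
  · rw [Complex.normSq_conj, ← neg_sub, h.normSq_sub hz.1]
    norm_num
  · rw [h.offP_eq hz.1 hz.2, Complex.conj_conj]
    exact h.hasNullData_minus h₁ hz.1

end IsFrameRow

/-! ### Extended frames -/

theorem SU11_entries {A : Mat2} (hA : A ∈ SU11) :
    A 1 0 = conj (A 0 1) ∧ A 1 1 = conj (A 0 0) ∧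
      A 0 0 * conj (A 0 0) - A 0 1 * conj (A 0 1) = 1 := by
  obtain ⟨h, hd⟩ := hA
  rw [Matrix.det_fin_two] at hd
  have h00 := congrFun (congrFun h 0) 0
  have h01 := congrFun (congrFun h 0) 1
  simp [sigma3, Matrix.mul_apply, Fin.sum_univ_two] at h00 h01
  have e1 : A 1 1 = conj (A 0 0) := by
    linear_combination -A 1 1 * h00 + conj (A 0 0) * hd + A 1 0 * h01
  have e2' : A 0 1 = conj (A 1 0) := by
    linear_combination -A 0 1 * h00 + conj (A 1 0) * hd + A 0 0 * h01
  have e2 : A 1 0 = conj (A 0 1) := by rw [e2', Complex.conj_conj]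
  refine ⟨e2, e1, ?_⟩
  rw [← e1, ← e2]
  exact hd

theorem inv_of_SU11 {A : Mat2} (hA : A ∈ SU11) :
    A⁻¹ = !![conj (A 0 0), -A 0 1; -conj (A 0 1), A 0 0] := by
  obtain ⟨h1, h2, -⟩ := SU11_entries hA
  rw [Matrix.inv_def, hA.2, Matrix.adjugate_fin_two, h1, h2]
  simp

theorem contDiffOn_dz {D : Set ℂ} (hD : IsOpen D) {g : ℂ → ℂ} (hg : ContDiffOn ℝ ∞ g D) :
    ContDiffOn ℝ ∞ (dz g) D := by
  have h := hg.fderiv_of_isOpen (m := ∞) hD (by simp)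
  exact ((h.clm_apply contDiffOn_const).sub
    (contDiffOn_const.mul (h.clm_apply contDiffOn_const))).div_const 2

theorem contDiffOn_dzbar {D : Set ℂ} (hD : IsOpen D) {g : ℂ → ℂ} (hg : ContDiffOn ℝ ∞ g D) :
    ContDiffOn ℝ ∞ (dzbar g) D := by
  have h := hg.fderiv_of_isOpen (m := ∞) hD (by simp)
  exact ((h.clm_apply contDiffOn_const).add
    (contDiffOn_const.mul (h.clm_apply contDiffOn_const))).div_const 2

theorem _root_.ContDiffOn.hasWirtinger {D : Set ℂ} (hD : IsOpen D) {g : ℂ → ℂ}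
    (hg : ContDiffOn ℝ ∞ g D) {z : ℂ} (hz : z ∈ D) : HasWirtinger g (dz g z) (dzbar g z) z :=
  ((hg.contDiffAt (hD.mem_nhds hz)).differentiableAt (by simp)).hasWirtinger

theorem dzbar_dz_comm {D : Set ℂ} (hD : IsOpen D) {g : ℂ → ℂ} (hg : ContDiffOn ℝ ∞ g D)
    {z : ℂ} (hz : z ∈ D) : dzbar (dz g) z = dz (dzbar g) z := by
  have hc := hg.contDiffAt (hD.mem_nhds hz)
  have hs : IsSymmSndFDerivAt ℝ g z := hc.isSymmSndFDerivAt (by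
    rw [minSmoothness_of_isRCLikeNormedField]; exact WithTop.coe_le_coe.2 le_top)
  have hd : HasFDerivAt (fderiv ℝ g) (fderiv ℝ (fderiv ℝ g) z) z :=
    ((hc.fderiv_right (m := ∞) (by simp)).differentiableAt (by simp)).hasFDerivAt
  have h1 : ∀ v : ℂ, HasFDerivAt (fun w => fderiv ℝ g w v)
      ((ContinuousLinearMap.apply ℝ ℂ v).comp (fderiv ℝ (fderiv ℝ g) z)) z := fun v =>
    (ContinuousLinearMap.apply ℝ ℂ v).hasFDerivAt.comp z hd
  have h2 : HasFDerivAt (dz g) _ z :=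
    ((h1 1).sub ((h1 Complex.I).const_mul Complex.I)).mul_const (2⁻¹ : ℂ)
  have h3 : HasFDerivAt (dzbar g) _ z :=
    ((h1 1).add ((h1 Complex.I).const_mul Complex.I)).mul_const (2⁻¹ : ℂ)
  rw [dzbar, h2.fderiv, dz, h3.fderiv]
  have := hs.eq Complex.I 1
  simp
  rw [this]
  ring

section frame

variable {D : Set ℂ} {f : ℂ → Nil3} {F : Circle → ℂ → Mat2} {z : ℂ}

theorem support_pos (hf : IsMinimalSurface f D) (hup : ∀ z ∈ D, 0 < unitNormal f z 2)
    (hz : z ∈ D) : 0 < support f z :=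
  mul_pos (Real.sqrt_pos.2 (hf.immersed z hz)) (hup z hz)

/-- A quarter of the support function, as a complex function; `e^{w/2}` is `i` times it. -/
def quarterSupport (f : ℂ → Nil3) (z : ℂ) : ℂ := (support f z : ℂ) / 4

theorem diracW_eq (f : ℂ → Nil3) (z : ℂ) :
    diracW f z = 2 * Complex.log (Complex.I * quarterSupport f z) := by
  rw [diracW, quarterSupport]
  congr 2
  ring

theorem quarterSupport_ne (h : 0 < support f z) : quarterSupport f z ≠ 0 := by
  simp [quarterSupport, h.ne']

theorem exp_diracW (h : 0 < support f z) :
    Complex.exp (diracW f z / 2) = Complex.I * quarterSupport f z := by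
  rw [diracW_eq, mul_div_cancel_left₀ _ (two_ne_zero), Complex.exp_log]
  simp [quarterSupport_ne h]

theorem exp_neg_diracW (h : 0 < support f z) :
    Complex.exp (-diracW f z / 2) = -Complex.I * (quarterSupport f z)⁻¹ := by
  rw [neg_div, Complex.exp_neg, exp_diracW h, mul_inv, Complex.inv_I]

theorem conj_quarterSupport (f : ℂ → Nil3) (z : ℂ) :
    conj (quarterSupport f z) = quarterSupport f z := by
  simp only [quarterSupport, map_div₀, Complex.conj_ofReal, map_ofNat]

theorem IsExtendedFrame.smooth_slice (hF : IsExtendedFrame f D F) (lam : Circle) (i j : Fin 2) :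
    ContDiffOn ℝ ∞ (fun w => F lam w i j) D := by
  have hi : ContDiffOn ℝ ∞ (fun w : ℂ => ((Complex.arg lam, w) : ℝ × ℂ)) D :=
    contDiffOn_const.prodMk contDiffOn_id
  have hm : Set.MapsTo (fun w : ℂ => ((Complex.arg lam, w) : ℝ × ℂ)) D (Set.univ ×ˢ D) :=
    fun w hw => ⟨trivial, hw⟩
  have := (hF.smooth i j).comp hi hm
  refine this.congr fun w _ => ?_
  simp [Circle.exp_arg]

theorem IsExtendedFrame.hasWirtinger (hD : IsOpen D) (hF : IsExtendedFrame f D F) (lam : Circle)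
    (hz : z ∈ D) (i j : Fin 2) :
    HasWirtinger (fun w => F lam w i j) ((F lam z * connU f lam z) i j)
      ((F lam z * connV f lam z) i j) z :=
  ((hF.smooth_slice lam i j).hasWirtinger hD hz).congr_deriv (hF.deriv_z lam z hz i j)
    (hF.deriv_zbar lam z hz i j)

/-- `e^{w/2}` is the entry of `F⁻¹ F_z̄` below the diagonal, hence smooth. -/
theorem contDiffOn_quarterSupport (hD : IsOpen D) (hf : IsMinimalSurface f D)
    (hup : ∀ z ∈ D, 0 < unitNormal f z 2) (hF : IsExtendedFrame f D F) :
    ContDiffOn ℝ ∞ (quarterSupport f) D := by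
  have h0 := hF.smooth_slice 1 0 0
  have h1 := hF.smooth_slice 1 1 0
  have h : ContDiffOn ℝ ∞ (fun z => -Complex.I * (F 1 z 0 0 * dzbar (fun w => F 1 w 1 0) z
      - F 1 z 1 0 * dzbar (fun w => F 1 w 0 0) z)) D :=
    contDiffOn_const.mul ((h0.mul (contDiffOn_dzbar hD h1)).sub
      (h1.mul (contDiffOn_dzbar hD h0)))
  refine h.congr fun z hz => ?_
  have hd := (hF.mem_SU11 1 z hz).2
  rw [Matrix.det_fin_two] at hd
  rw [hF.deriv_zbar 1 z hz, hF.deriv_zbar 1 z hz]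
  simp only [connV, Matrix.mul_apply, Fin.sum_univ_two, Matrix.of_apply, Matrix.cons_val',
    Matrix.cons_val_zero, Matrix.cons_val_one, Matrix.cons_val_fin_one, Circle.coe_one,
    exp_diracW (support_pos hf hup hz)]
  linear_combination Complex.I ^ 2 * quarterSupport f z * hd + quarterSupport f z * Complex.I_sq

/-- `B` is, up to the factor `i κ`, the entry of `F⁻¹ F_z` below the diagonal. -/
theorem abreschRosenberg_eq (hf : IsMinimalSurface f D)
    (hup : ∀ z ∈ D, 0 < unitNormal f z 2) (hF : IsExtendedFrame f D F) (hz : z ∈ D) :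
    abreschRosenberg f z = Complex.I * (quarterSupport f z
      * (F 1 z 0 0 * dz (fun w => F 1 w 1 0) z - F 1 z 1 0 * dz (fun w => F 1 w 0 0) z)) := by
  have hd := (hF.mem_SU11 1 z hz).2
  have hk := quarterSupport_ne (support_pos hf hup hz)
  rw [Matrix.det_fin_two] at hd
  rw [hF.deriv_z 1 z hz, hF.deriv_z 1 z hz]
  simp only [connU, Matrix.mul_apply, Fin.sum_univ_two, Matrix.of_apply, Matrix.cons_val',
    Matrix.cons_val_zero, Matrix.cons_val_one, Matrix.cons_val_fin_one, Circle.coe_one,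
    exp_neg_diracW (support_pos hf hup hz)]
  have hkk := mul_inv_cancel₀ hk
  linear_combination Complex.I ^ 2 * abreschRosenberg f z * hd
    + abreschRosenberg f z * Complex.I_sq + Complex.I ^ 2 * abreschRosenberg f z
      * (F 1 z 0 0 * F 1 z 1 1 - F 1 z 0 1 * F 1 z 1 0) * hkk

theorem hasWirtinger_diracW {k₁ k₂ : ℂ} (hk : 0 < support f z)
    (h : HasWirtinger (quarterSupport f) k₁ k₂ z) :
    HasWirtinger (diracW f) (2 * k₁ / quarterSupport f z) (2 * k₂ / quarterSupport f z) z := by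
  have hk0 := quarterSupport_ne hk
  have hs : Complex.I * quarterSupport f z ∈ Complex.slitPlane := by
    rw [Complex.mem_slitPlane_iff]
    right
    simp [quarterSupport, hk.ne']
  have hl := ((Complex.hasDerivAt_log hs).hasFDerivAt.restrictScalars ℝ).comp z
    (h.const_mul Complex.I)
  have he : diracW f = fun w => 2 * Complex.log (Complex.I * quarterSupport f w) :=
    funext (diracW_eq f)
  rw [he]
  refine (hl.const_mul 2).congr_fderiv ?_
  ext v
  simp
  field_simp
  linear_combination -(k₁ * v + k₂ * conj v) * Complex.I_sq

/-- For a real function, `∂_z̄` is the conjugate of `∂_z`. -/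
theorem dzbar_quarterSupport (h : HasWirtinger (quarterSupport f) (dz (quarterSupport f) z)
    (dzbar (quarterSupport f) z) z) :
    dzbar (quarterSupport f) z = conj (dz (quarterSupport f) z) := by
  have h1 := h.conj_comp
  simp only [conj_quarterSupport] at h1
  exact h1.dzbar_eq

/-- The Abresch-Rosenberg differential is holomorphic: the `λ⁻¹`-part of the flatness equation
for the lower left entry. -/
theorem hasWirtinger_abreschRosenberg (hD : IsOpen D) (hf : IsMinimalSurface f D)
    (hup : ∀ z ∈ D, 0 < unitNormal f z 2) (hF : IsExtendedFrame f D F) (hz : z ∈ D) :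
    HasWirtinger (abreschRosenberg f) (dz (abreschRosenberg f) z) 0 z := by
  have hks := contDiffOn_quarterSupport hD hf hup hF
  have hk := hks.hasWirtinger hD hz
  have hpos := support_pos hf hup hz
  have hk0 := quarterSupport_ne hpos
  have h0 := hF.smooth_slice 1 0 0
  have h1 := hF.smooth_slice 1 1 0
  have w00 := hF.hasWirtinger hD 1 hz 0 0
  have w01 := hF.hasWirtinger hD 1 hz 0 1
  have w10 := hF.hasWirtinger hD 1 hz 1 0
  have w11 := hF.hasWirtinger hD 1 hz 1 1
  have hdw := (hasWirtinger_diracW hpos hk).dz_eq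
  have hdwb := (hasWirtinger_diracW hpos hk).dzbar_eq
  simp only [connU, connV, Matrix.mul_apply, Fin.sum_univ_two, Matrix.of_apply, Matrix.cons_val',
    Matrix.cons_val_zero, Matrix.cons_val_one, Matrix.cons_val_fin_one, Circle.coe_one,
    exp_diracW hpos, exp_neg_diracW hpos, hdw, hdwb] at w00 w01 w10 w11
  -- the gauge term `-w_z̄ / 4` of `F⁻¹ F_z̄`
  have hv := (((contDiffOn_dzbar hD hks).hasWirtinger hD hz).mul (hk.inv hk0)).const_mul (-1 / 2)
  have near : ∀ i, (fun w => dzbar (fun w => F 1 w i 0) w) =ᶠ[𝓝 z] fun w =>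
      F 1 w i 0 * (-1 / 2 * (dzbar (quarterSupport f) w * (quarterSupport f w)⁻¹))
        + F 1 w i 1 * (Complex.I * quarterSupport f w) := by
    intro i
    filter_upwards [hD.mem_nhds hz] with w hw
    have hpw := support_pos hf hup hw
    rw [hF.deriv_zbar 1 w hw]
    simp only [connV, Matrix.mul_apply, Fin.sum_univ_two, Matrix.of_apply, Matrix.cons_val',
      Matrix.cons_val_zero, Matrix.cons_val_one, Matrix.cons_val_fin_one, Circle.coe_one,
      exp_diracW hpw, (hasWirtinger_diracW hpw (hks.hasWirtinger hD hw)).dzbar_eq]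
    ring
  have c00 := ((w00.mul hv).add (w01.mul (hk.const_mul Complex.I))).congr_of_eventuallyEq (near 0)
  have c10 := ((w10.mul hv).add (w11.mul (hk.const_mul Complex.I))).congr_of_eventuallyEq (near 1)
  have d00 := (contDiffOn_dz hD h0).hasWirtinger hD hz
  have d10 := (contDiffOn_dz hD h1).hasWirtinger hD hz
  rw [dzbar_dz_comm hD h0 hz, c00.dz_eq] at d00
  rw [dzbar_dz_comm hD h1 hz, c10.dz_eq] at d10
  have hB := ((hk.mul ((w00.mul d10).sub (w10.mul d00))).const_mul
    Complex.I).congr_of_eventuallyEq (h := abreschRosenberg f)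
      (Filter.eventually_of_mem (hD.mem_nhds hz) fun w hw => abreschRosenberg_eq hf hup hF hw)
  refine hB.congr_deriv hB.dz_eq.symm ?_
  rw [w00.dz_eq, w10.dz_eq]
  field_simp
  ring

end frame

/-! ### The Sym formula for an extended frame -/

section frame

variable {D : Set ℂ} {f : ℂ → Nil3} {F : Circle → ℂ → Mat2} {z : ℂ}

/-- The first row of an extended frame; the diagonal terms use `w_z = 2 κ_z / κ`. -/
theorem isFrameRow_of_isExtendedFrame (hD : IsOpen D) (hf : IsMinimalSurface f D)
    (hup : ∀ z ∈ D, 0 < unitNormal f z 2) (hF : IsExtendedFrame f D F) :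
    IsFrameRow D (quarterSupport f) (abreschRosenberg f)
      (fun z => dz (quarterSupport f) z / (2 * quarterSupport f z))
      (fun t z => F (Circle.exp t) z 0 0) (fun t z => F (Circle.exp t) z 0 1) := by
  have hks := contDiffOn_quarterSupport hD hf hup hF
  refine ⟨hD, hF.smooth 0 0, hF.smooth 0 1,
    fun t z hz => (SU11_entries (hF.mem_SU11 _ z hz)).2.2, fun t z hz => ?_, fun t z hz => ?_,
    fun z hz => ⟨support f z / 4, by have := support_pos hf hup hz; positivity, by
      simp [quarterSupport]⟩, fun z hz => ?_,
    fun z hz => hasWirtinger_abreschRosenberg hD hf hup hF hz⟩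
  · have hpos := support_pos hf hup hz
    have hk := hks.hasWirtinger hD hz
    have hk0 := quarterSupport_ne hpos
    have hw := hasWirtinger_diracW hpos hk
    refine (hF.hasWirtinger hD _ hz 0 0).congr_deriv ?_ ?_
    · simp only [connU, Matrix.mul_apply, Fin.sum_univ_two, Matrix.of_apply, Matrix.cons_val',
        Matrix.cons_val_zero, Matrix.cons_val_one, Matrix.cons_val_fin_one,
        exp_neg_diracW hpos, hw.dz_eq, offQ]
      field_simp
      ring
    · simp only [connV, Matrix.mul_apply, Fin.sum_univ_two, Matrix.of_apply, Matrix.cons_val',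
        Matrix.cons_val_zero, Matrix.cons_val_one, Matrix.cons_val_fin_one,
        exp_diracW hpos, hw.dzbar_eq, offP, dzbar_quarterSupport hk, map_mul, map_neg, map_div₀,
        map_inv₀, map_ofNat, conj_quarterSupport, Complex.conj_I, ← Circle.coe_inv_eq_conj,
        Circle.coe_inv, inv_inv]
      field_simp
      ring
  · have hpos := support_pos hf hup hz
    have hk := hks.hasWirtinger hD hz
    have hk0 := quarterSupport_ne hpos
    have hw := hasWirtinger_diracW hpos hk
    refine (hF.hasWirtinger hD _ hz 0 1).congr_deriv ?_ ?_
    · simp only [connU, Matrix.mul_apply, Fin.sum_univ_two, Matrix.of_apply, Matrix.cons_val',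
        Matrix.cons_val_zero, Matrix.cons_val_one, Matrix.cons_val_fin_one,
        exp_diracW hpos, hw.dz_eq, offP]
      field_simp
      ring
    · simp only [connV, Matrix.mul_apply, Fin.sum_univ_two, Matrix.of_apply, Matrix.cons_val',
        Matrix.cons_val_zero, Matrix.cons_val_one, Matrix.cons_val_fin_one,
        exp_neg_diracW hpos, hw.dzbar_eq, offQ, dzbar_quarterSupport hk, map_mul, map_neg, map_div₀,
        map_inv₀, map_ofNat, conj_quarterSupport, Complex.conj_I, ← Circle.coe_inv_eq_conj,
        Circle.coe_inv, inv_inv]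
      field_simp
      ring
  · have hk := hks.hasWirtinger hD hz
    have hk0 := quarterSupport_ne (support_pos hf hup hz)
    refine hk.congr_deriv ?_ ?_
    · field_simp
    · simp only [map_mul, map_div₀, map_ofNat, conj_quarterSupport, dzbar_quarterSupport hk]
      field_simp

theorem differentiableAt_of_hasWirtinger {g : ℂ → ℂ} {p : ℂ} (h : HasWirtinger g p 0 z) :
    DifferentiableAt ℂ g z := by
  have h1 : (ContinuousLinearMap.toSpanSingleton ℂ p).restrictScalars ℝ = wirtingerCLM p 0 := by
    ext v
    simp [mul_comm]
  exact (hasFDerivAt_of_restrictScalars ℝ h h1).differentiableAt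

/-- A holomorphic function which is not identically zero has isolated zeros. -/
theorem abreschRosenberg_isolated (hD : IsOpen D) (hDc : IsConnected D)
    (hf : IsMinimalSurface f D) (hup : ∀ z ∈ D, 0 < unitNormal f z 2)
    (hB : ∃ z ∈ D, abreschRosenberg f z ≠ 0) (hF : IsExtendedFrame f D F) (hz : z ∈ D) :
    ∀ᶠ w in 𝓝[≠] z, abreschRosenberg f w ≠ 0 := by
  have hd : DifferentiableOn ℂ (abreschRosenberg f) D := fun w hw =>
    (differentiableAt_of_hasWirtinger
      (hasWirtinger_abreschRosenberg hD hf hup hF hw)).differentiableWithinAt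
  have ha := hd.analyticOnNhd hD
  by_contra hc
  have hfr : ∃ᶠ w in 𝓝[≠] z, abreschRosenberg f w = 0 := by
    rw [Filter.Frequently]
    exact hc
  obtain ⟨w, hw, hne⟩ := hB
  exact hne (ha.eqOn_zero_of_preconnected_of_frequently_eq_zero hDc.isPreconnected hz hfr hw)

theorem lamDeriv_exp (M : Circle → Mat2) (t : ℝ) (i j : Fin 2) :
    lamDeriv M (Circle.exp t) i j
      = -Complex.I * deriv (fun τ : ℝ => M (Circle.exp τ) i j) t := by
  have h := deriv_comp_add_const (fun τ : ℝ => M (Circle.exp τ) i j) t 0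
  rw [zero_add] at h
  simp only [lamDeriv, Matrix.of_apply, ← Circle.exp_add]
  rw [h]

theorem symN_eq (hF : IsExtendedFrame f D F) (lam : Circle) (hz : z ∈ D) :
    symN F lam z = (Complex.I / 2) •
      !![F lam z 0 0 * conj (F lam z 0 0) + F lam z 0 1 * conj (F lam z 0 1),
          -2 * (F lam z 0 0 * F lam z 0 1);
        2 * (conj (F lam z 0 0) * conj (F lam z 0 1)),
          -(F lam z 0 0 * conj (F lam z 0 0) + F lam z 0 1 * conj (F lam z 0 1))] := by
  obtain ⟨h1, h2, -⟩ := SU11_entries (hF.mem_SU11 lam z hz)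
  rw [symN, inv_of_SU11 (hF.mem_SU11 lam z hz)]
  congr 1
  ext i j
  fin_cases i <;> fin_cases j <;>
    simp [sigma3, Matrix.mul_apply, Fin.sum_univ_two, h1, h2] <;> ring

/-- Since `-i λ ∂_λ = -∂_t`, the first term of `m_±` is `-F_t F⁻¹`. -/
theorem symM_zero_zero (hF : IsExtendedFrame f D F) (ε : ℂ) (t : ℝ) (hz : z ∈ D) :
    symM ε F (Circle.exp t) z 0 0 = potDiag ε (fun t z => F (Circle.exp t) z 0 0)
      (fun t z => F (Circle.exp t) z 0 1) t z := by
  rw [symM, symN_eq hF _ hz, inv_of_SU11 (hF.mem_SU11 _ z hz)]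
  simp [Matrix.mul_apply, Fin.sum_univ_two, lamDeriv_exp, potDiag]
  linear_combination (deriv (fun τ => F (Circle.exp τ) z 0 0) t * conj (F (Circle.exp t) z 0 0)
    - deriv (fun τ => F (Circle.exp τ) z 0 1) t * conj (F (Circle.exp t) z 0 1)) * Complex.I_sq

theorem symM_zero_one (hF : IsExtendedFrame f D F) (ε : ℂ) (t : ℝ) (hz : z ∈ D) :
    symM ε F (Circle.exp t) z 0 1 = potOff ε (fun t z => F (Circle.exp t) z 0 0)
      (fun t z => F (Circle.exp t) z 0 1) t z := by
  rw [symM, symN_eq hF _ hz, inv_of_SU11 (hF.mem_SU11 _ z hz)]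
  simp [Matrix.mul_apply, Fin.sum_univ_two, lamDeriv_exp, potOff]
  linear_combination (-deriv (fun τ => F (Circle.exp τ) z 0 0) t * F (Circle.exp t) z 0 1
    + deriv (fun τ => F (Circle.exp τ) z 0 1) t * F (Circle.exp t) z 0 0) * Complex.I_sq

theorem XiNil_symHat (hF : IsExtendedFrame f D F) (ε : ℂ) (t : ℝ) (hz : z ∈ D) :
    XiNil (symHat ε F (Circle.exp t) z) = symSurface ε (fun t z => F (Circle.exp t) z 0 0)
      (fun t z => F (Circle.exp t) z 0 1) t z := by
  have e : ∀ τ : ℝ, symM ε F (Circle.exp τ) z 0 0 = _ := fun τ => symM_zero_zero hF ε τ hz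
  funext k
  fin_cases k <;>
    simp [XiNil, symHat, symSurface, offDiagPart, diagPart, lamDeriv_exp,
      symM_zero_one hF ε t hz, e]

/-! ### Surfaces with the same Maurer-Cartan form -/

theorem isRigidMotion_nilMul (p : Nil3) : IsRigidMotion (nilMul p) := by
  have hd : ∀ x, HasFDerivAt (nilMul p) (ContinuousLinearMap.pi
      ![ContinuousLinearMap.proj 0, ContinuousLinearMap.proj 1,
        ContinuousLinearMap.proj 2 + (2⁻¹ : ℝ) • (p 0 • ContinuousLinearMap.proj 1
          - p 1 • ContinuousLinearMap.proj 0)] : Nil3 →L[ℝ] Nil3) x := by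
    intro x
    have hx : ∀ i : Fin 3, HasFDerivAt (fun y : Nil3 => y i)
        (ContinuousLinearMap.proj (R := ℝ) (φ := fun _ : Fin 3 => ℝ) i) x := fun i =>
      (ContinuousLinearMap.proj (R := ℝ) (φ := fun _ : Fin 3 => ℝ) i).hasFDerivAt
    refine hasFDerivAt_pi.2 (Fin.forall_fin_succ.2 ⟨(hx 0).const_add (p 0),
      Fin.forall_fin_succ.2 ⟨(hx 1).const_add (p 1), Fin.forall_fin_succ.2 ⟨?_,
        fun i => i.elim0⟩⟩⟩)
    refine ((((hx 2).const_add (p 2))).add ((((hx 1).const_mul (p 0)).sub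
      ((hx 0).mul_const (p 1))).mul_const (2⁻¹ : ℝ))).congr_fderiv ?_
    rfl
  refine ⟨?_, ?_, ?_⟩
  · have hx : ∀ i : Fin 3, ContDiff ℝ ∞ (fun y : Nil3 => y i) := fun i => contDiff_apply ℝ ℝ i
    refine contDiff_pi.2 (Fin.forall_fin_succ.2 ⟨contDiff_const.add (hx 0),
      Fin.forall_fin_succ.2 ⟨contDiff_const.add (hx 1), Fin.forall_fin_succ.2 ⟨?_,
        fun i => i.elim0⟩⟩⟩)
    exact (contDiff_const.add (hx 2)).add (((contDiff_const.mul (hx 1)).sub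
      ((hx 0).mul contDiff_const)).div_const 2)
  · refine Function.bijective_iff_has_inverse.2 ⟨nilMul (-p), fun x => ?_, fun x => ?_⟩ <;>
      funext k <;> fin_cases k <;> simp [nilMul] <;> ring
  · intro x v w
    rw [(hd x).fderiv]
    simp [nilMetric, nilMul]
    ring

/-- Two surfaces over a connected domain with the same Maurer-Cartan coefficients differ by a
left translation. -/
theorem exists_leftTranslation (hD : IsOpen D) (hDc : IsConnected D) {f₁ f₂ : ℂ → Nil3}
    (h₁ : DifferentiableOn ℝ f₁ D) (h₂ : DifferentiableOn ℝ f₂ D)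
    (h : ∀ z ∈ D, ∀ k, phi f₁ z k = phi f₂ z k) :
    ∃ p, ∀ z ∈ D, f₁ z = nilMul p (f₂ z) := by
  obtain ⟨z₀, hz₀⟩ := hDc.nonempty
  have hmc : ∀ z ∈ D, ∀ v, leftTriv (f₁ z) (fderiv ℝ f₁ z v)
      = leftTriv (f₂ z) (fderiv ℝ f₂ z v) := by
    intro z hz v
    have e1 : leftTriv (f₁ z) (fderiv ℝ f₁ z 1) = leftTriv (f₂ z) (fderiv ℝ f₂ z 1) := by
      funext k
      have := mcForm_one f₁ z k
      rw [h z hz k, ← mcForm_one] at this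
      exact this
    have eI : leftTriv (f₁ z) (fderiv ℝ f₁ z Complex.I)
        = leftTriv (f₂ z) (fderiv ℝ f₂ z Complex.I) := by
      funext k
      have := mcForm_I f₁ z k
      rw [h z hz k, ← mcForm_I] at this
      exact this
    have hl : ∀ x a b : Nil3, ∀ r s : ℝ, leftTriv x (r • a + s • b)
        = r • leftTriv x a + s • leftTriv x b := by
      intro x a b r s
      funext k
      fin_cases k <;> simp [leftTriv]
      ring
    have hv : v = v.re • (1 : ℂ) + v.im • Complex.I := by
      apply Complex.ext <;> simp
    rw [hv, map_add, map_add, map_smul, map_smul, map_smul, map_smul, hl, hl, e1, eI]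
  have hd₁ : ∀ z ∈ D, ∀ k, HasFDerivAt (fun w => f₁ w k)
      ((ContinuousLinearMap.proj k).comp (fderiv ℝ f₁ z)) z := fun z hz =>
    hasFDerivAt_pi'.1 (h₁.differentiableAt (hD.mem_nhds hz)).hasFDerivAt
  have hd₂ : ∀ z ∈ D, ∀ k, HasFDerivAt (fun w => f₂ w k)
      ((ContinuousLinearMap.proj k).comp (fderiv ℝ f₂ z)) z := fun z hz =>
    hasFDerivAt_pi'.1 (h₂.differentiableAt (hD.mem_nhds hz)).hasFDerivAt
  have const : ∀ g : ℂ → ℝ, (∀ z ∈ D, HasFDerivAt g (0 : ℂ →L[ℝ] ℝ) z) →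
      ∀ z ∈ D, g z = g z₀ := fun g hg z hz =>
    hD.is_const_of_fderiv_eq_zero hDc.isPreconnected
      (fun w hw => (hg w hw).differentiableAt.differentiableWithinAt)
      (fun w hw => (hg w hw).fderiv) hz hz₀
  have c0 := const (fun w => f₁ w 0 - f₂ w 0) fun z hz => by
    refine ((hd₁ z hz 0).sub (hd₂ z hz 0)).congr_fderiv ?_
    ext v
    have := congrFun (hmc z hz v) 0
    simp [leftTriv] at this
    simp [this]
  have c1 := const (fun w => f₁ w 1 - f₂ w 1) fun z hz => by
    refine ((hd₁ z hz 1).sub (hd₂ z hz 1)).congr_fderiv ?_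
    ext v
    have := congrFun (hmc z hz v) 1
    simp [leftTriv] at this
    simp [this]
  set α := f₁ z₀ 0 - f₂ z₀ 0
  set β := f₁ z₀ 1 - f₂ z₀ 1
  -- the third coordinate of a left translation by `(α, β, ·)` also carries the twist term
  have c2 := const (fun w => f₁ w 2 - f₂ w 2 - 2⁻¹ * (α * f₂ w 1 - β * f₂ w 0)) fun z hz => by
    refine (((hd₁ z hz 2).sub (hd₂ z hz 2)).sub ((((hd₂ z hz 1).const_mul α).sub
      ((hd₂ z hz 0).const_mul β)).const_mul 2⁻¹)).congr_fderiv ?_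
    ext v
    have t0 := congrFun (hmc z hz v) 0
    have t1 := congrFun (hmc z hz v) 1
    have t2 := congrFun (hmc z hz v) 2
    have a0 := c0 z hz
    have a1 := c1 z hz
    simp [leftTriv] at t0 t1 t2
    simp
    rw [t0, t1] at t2
    linear_combination t2 - (fderiv ℝ f₂ z v 0) / 2 * a1 + (fderiv ℝ f₂ z v 1) / 2 * a0
  refine ⟨![α, β, f₁ z₀ 2 - f₂ z₀ 2 - 2⁻¹ * (α * f₂ z₀ 1 - β * f₂ z₀ 0)], fun z hz => ?_⟩
  have a0 := c0 z hz
  have a1 := c1 z hz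
  have a2 := c2 z hz
  funext k
  fin_cases k <;> simp [nilMul]
  · linear_combination a0
  · linear_combination a1
  · linear_combination a2

/-! ### Frames associated with generating spinors -/

theorem sqrtI_sq : sqrtI ^ 2 = Complex.I := by
  rw [sqrtI, ← Complex.exp_nat_mul]
  have : ((2 : ℕ) : ℂ) * (Complex.I * (Real.pi : ℂ) / 4) = Real.pi / 2 * Complex.I := by
    push_cast; ring
  rw [this, Complex.exp_pi_div_two_mul_I]

theorem conj_sqrtI : conj sqrtI = sqrtI⁻¹ := by
  rw [sqrtI, ← Complex.exp_conj, ← Complex.exp_neg]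
  congr 1
  simp only [map_div₀, map_mul, Complex.conj_I, Complex.conj_ofReal, map_ofNat]
  ring

/-- The null data of `f` read off from the frame of its generating spinors: by `h = 2 (|ψ₁|² -
|ψ₂|²)`, the normalising factor of the frame is `√(h / 2)`. -/
theorem hasNullData_of_spinorFrame {ψ₁ ψ₂ : ℂ} {A : Mat2} (h : IsSpinorAt f z ψ₁ ψ₂)
    (hpos : 0 < support f z) (hA : A = spinorFrame ψ₁ ψ₂) :
    HasNullData f z (2 * quarterSupport f z) (A 0 0) (conj (A 0 1)) := by
  have hs := (hasNullData_of_isSpinorAt h).support_eq (neg_ne_zero.2 Complex.I_ne_zero)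
  simp [Complex.normSq_eq_norm_sq] at hs
  have hr : 0 < ‖ψ₁‖ ^ 2 - ‖ψ₂‖ ^ 2 := by linarith
  set r := Real.sqrt (‖ψ₁‖ ^ 2 - ‖ψ₂‖ ^ 2) with hrdef
  have hr0 : (r : ℂ) ≠ 0 := by exact_mod_cast (Real.sqrt_pos.2 hr).ne'
  have hr2 : 2 * quarterSupport f z = (r : ℂ) ^ 2 := by
    rw [← Complex.ofReal_pow, hrdef, Real.sq_sqrt hr.le, quarterSupport, hs]
    push_cast
    ring
  have hI0 : sqrtI ≠ 0 := Complex.exp_ne_zero _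
  have e0 : A 0 0 = (r : ℂ)⁻¹ * (sqrtI⁻¹ * ψ₁) := by rw [hA]; simp [spinorFrame, hrdef]
  have e1 : conj (A 0 1) = (r : ℂ)⁻¹ * (sqrtI * conj ψ₂) := by
    rw [hA]; simp [spinorFrame, conj_sqrtI, ← hrdef]
  have hsi := sqrtI_sq
  have hsi' : sqrtI⁻¹ ^ 2 = -Complex.I := by rw [inv_pow, hsi, Complex.inv_I]
  obtain ⟨h0, h1, h2⟩ := h
  have f0 : (r : ℂ) ^ 2 * A 0 0 ^ 2 = -Complex.I * ψ₁ ^ 2 := by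
    rw [e0, ← hsi']; field_simp
  have f1 : (r : ℂ) ^ 2 * conj (A 0 1) ^ 2 = Complex.I * conj ψ₂ ^ 2 := by
    rw [e1, ← hsi]; field_simp
  have f2 : (r : ℂ) ^ 2 * (A 0 0 * conj (A 0 1)) = ψ₁ * conj ψ₂ := by
    rw [e0, e1]; field_simp
  rw [hr2]
  refine ⟨?_, ?_, ?_⟩
  · rw [h0]
    linear_combination Complex.I * f0 + Complex.I * f1 + (conj ψ₂ ^ 2 - ψ₁ ^ 2) * Complex.I_sq
  · rw [h1]
    linear_combination f0 - f1
  · rw [h2]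
    linear_combination -2 * f2

end frame

end NilSurf

end
open NilSurf
theorem theorem3p3
    (D : Set ℂ) (hD : IsOpen D) (hDc : IsConnected D)
    (f : ℂ → Nil3) (hf : IsMinimalSurface f D)
    (hup : ∀ z ∈ D, 0 < unitNormal f z 2)
    (hB : ∃ z ∈ D, abreschRosenberg f z ≠ 0)
    (F : Circle → ℂ → Mat2) (hF : IsExtendedFrame f D F) :
    -- the zeros of `B` are isolated
    (∀ z ∈ D, ∀ᶠ w in 𝓝[≠] z, abreschRosenberg f w ≠ 0) ∧
    (∀ lam : Circle,
      -- minimality; the oriented normal of `f_-` is upward, that of `f_+` downward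
      IsMinimalSurface (symMinus F lam) D ∧
      (∀ z ∈ D, 0 < unitNormal (symMinus F lam) z 2) ∧
      IsMinimalSurface (symPlus F lam) {z ∈ D | abreschRosenberg f z ≠ 0} ∧
      (∀ z ∈ D, abreschRosenberg f z ≠ 0 → unitNormal (symPlus F lam) z 2 < 0) ∧
      -- `N_m` is the normal Gauss map (for `f_+`, after a half-turn about the `x₃`-axis)
      (∀ z ∈ D, symN F lam z = hyperbolicPoint (gaussMap (symMinus F lam) z)) ∧
      (∀ z ∈ D, abreschRosenberg f z ≠ 0 →
        symN F lam z = hyperbolicPoint (gaussMap (fun w => halfTurn (symPlus F lam w)) z)) ∧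
      -- `f_-` and `f_+` are dual to each other
      IsDual (symMinus F lam) (symPlus F lam) {z ∈ D | abreschRosenberg f z ≠ 0} ∧
      IsDual (symPlus F lam) (symMinus F lam) {z ∈ D | abreschRosenberg f z ≠ 0}) ∧
    -- at `λ = 1`, for the frame associated with generating spinors of `f`
    (IsSpinorNormalized f D F →
      (∃ T : Nil3 → Nil3, IsRigidMotion T ∧ ∀ z ∈ D, symMinus F 1 z = T (f z)) ∧
      IsDual f (symPlus F 1) {z ∈ D | abreschRosenberg f z ≠ 0}) := by
  have hrow := isFrameRow_of_isExtendedFrame hD hf hup hF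
  have hm : ∀ t, ∀ w ∈ D, symMinus F (Circle.exp t) w = _ := fun t w hw =>
    XiNil_symHat hF (-1) t hw
  have hp : ∀ t, ∀ w ∈ D, symPlus F (Circle.exp t) w = _ := fun t w hw =>
    XiNil_symHat hF 1 t hw
  refine ⟨fun z hz => abreschRosenberg_isolated hD hDc hf hup hB hF hz, fun lam => ?_, ?_⟩
  · rw [← Circle.exp_arg lam]
    set t := Complex.arg lam
    refine ⟨hrow.isMinimalSurface_minus (hm t), fun z hz => hrow.unitNormal_minus_pos (hm t) hz,
      hrow.isMinimalSurface_plus (hp t), fun z hz hne => hrow.unitNormal_plus_neg (hp t) hz hne,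
      fun z hz => ?_, fun z hz hne => ?_, hrow.isDual_minus_plus (hm t) (hp t),
      hrow.isDual_plus_minus (hm t) (hp t)⟩
    · rw [hrow.gaussMap_minus (hm t) hz, hyperbolicPoint_frame (hrow.det t z hz), symN_eq hF _ hz]
    · rw [hrow.gaussMap_halfTurn_plus (hp t) hz hne, hyperbolicPoint_frame (hrow.det t z hz),
        symN_eq hF _ hz]
  · rintro ⟨ψ₁, ψ₂, hψ⟩
    have hm1 := hm 0
    have hp1 := hp 0
    rw [Circle.exp_zero] at hm1 hp1
    have hdat : ∀ z ∈ D, HasNullData f z (2 * Complex.I * offP (quarterSupport f) 0 z)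
        (F (Circle.exp 0) z 0 0) ((starRingEnd ℂ) (F (Circle.exp 0) z 0 1)) := by
      intro z hz
      have e : 2 * Complex.I * offP (quarterSupport f) 0 z = 2 * quarterSupport f z := by
        simp only [offP, Circle.exp_zero, Circle.coe_one]
        linear_combination -2 * quarterSupport f z * Complex.I_sq
      rw [e, Circle.exp_zero]
      exact hasNullData_of_spinorFrame (hψ z hz).1 (support_pos hf hup hz) (hψ z hz).2
    refine ⟨?_, fun z hz => ?_⟩
    · obtain ⟨p, hp⟩ := exists_leftTranslation hD hDc
        ((hrow.contDiffOn_of_eq hm1).differentiableOn (by simp))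
        (hf.smooth.differentiableOn (by simp)) fun z hz k => by
          obtain ⟨a0, a1, a2⟩ := hrow.hasNullData_minus hm1 hz
          obtain ⟨b0, b1, b2⟩ := hdat z hz
          fin_cases k
          · exact a0.trans b0.symm
          · exact a1.trans b1.symm
          · exact a2.trans b2.symm
      exact ⟨nilMul p, isRigidMotion_nilMul p, hp⟩
    · refine (hdat z hz.1).dual (hrow.two_I_offP_ne hz.1 0) ?_ rfl ?_
      · rw [Complex.normSq_conj, hrow.normSq_sub hz.1, one_pow]
      · have e := hrow.offQ_eq hz.1 0
        rw [Circle.exp_zero, Circle.coe_one, inv_one, one_pow, one_mul] at e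
        rw [e, Complex.conj_conj]
        exact hrow.hasNullData_plus hp1 hz.1
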